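/- **Notation.** Let $\mathcal F_3$ be the set of twice continuously differentiable $f:\mathbb R\to\mathbb R$ with $|f''(x)-f''(y)|\le|x-y|$ for all $x,y\in\mathbb R$. For probability measures $P,Q$ on $\mathbb R$ let $$\zeta_3(P,Q)=\sup\Big\{\Big|\int f\,dP-\int f\,dQ\Big| : f\in\mathcal F_3,\ f\text{ bounded}\Big\}\in[0,\infty].$$ Let $\mathcal P_3$ be the set of probability measures $P$ on $\mathbb R$ with $\int|x|^3\,dP(x)<\infty$ and standard deviation $\sigma(P)>0$. Let $\mu(P)$ be the mean of $P$, let $\widetilde P$ be the image of $P$ under $x\mapsto(x-\mu(P))/\sigma(P)$, let $\varrho(P)=\int|x|^3\,d\widetilde P(x)$, and let $P^{*n}$ be the $n$-th convolution power of $P$. Let $\mathrm N$ be the standard normal law, $\mathrm B_{n,1/2}=\big(\tfrac12(\delta_0+\delta_1)\big)^{*n}$ the symmetric binomial law, and $$\varepsilon_n=\zeta_3\big(\widetilde{\mathrm B_{n,1/2}},\mathrm N\big)\qquad(n\in\mathbb N=\{1,2,\dots\}).$$ For $\varrho\ge1$ put $$B(\varrho)=\sqrt{\tfrac12\varrho^2+\tfrac12\varrho\sqrt{\varrho^2+8}-2},\qquad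 p_\varrho=\tfrac12-\tfrac12\sqrt{\tfrac{\varrho}{2}\sqrt{\varrho^2+8}-\tfrac{\varrho^2}{2}-1},$$ and, with $p=p_\varrho$, $q=1-p$, let $P_\varrho=q\,\delta_{-\sqrt{p/q}}+p\,\delta_{\sqrt{q/p}}$. **Theorem.** (i) For every $n\in\mathbb N$ one has $\varepsilon_n<\infty$, and for every $P\in\mathcal P_3$ $$\zeta_3\big(\widetilde{P^{*n}},\mathrm N\big)\le\frac{B(\varrho(P))}{6\sqrt n}+\varepsilon_n .$$ (ii) The leading term for $n\to\infty$ is optimal in the following sense. The function $f(x)=x^3/6$ belongs to $\mathcal F_3$, and for every $\varrho\in[1,\infty)$ one has $P_\varrho\in\mathcal P_3$, $\varrho(P_\varrho)=\varrho$, and $$\frac{B(\varrho)}6=\lim_{n\to\infty}\sqrt n\,\zeta_3\big(\widetilde{P_\varrho^{*n}},\mathrm N\big)=\sqrt k\,\Big|\int f\,d\widetilde{P_\varrho^{*k}}-\int f\,d\mathrm N\Big|\quad\text{for every }k\in\mathbb N,$$ where $f$ is integrable with respect to $\widetilde{P_\varrho^{*k}}$ and $\mathrm N$. (iii) The leading term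 for $\varrho\to1$ is asymptotically exact: for every $n\in\mathbb N$, $$\lim_{P\in\mathcal P_3,\ \varrho(P)\to1}\zeta_3\big(\widetilde{P^{*n}},\mathrm N\big)=\varepsilon_n .$$ -/

import Mathlib

open MeasureTheory ProbabilityTheory Filter Topology
open scoped ENNReal NNReal

namespace BerryEsseenZeta

noncomputable section

/-- The class `𝓕₃`: twice continuously differentiable functions `f : ℝ → ℝ` whose second
derivative is Lipschitz with constant at most `1`. -/
def F3 : Set (ℝ → ℝ) :=
  {f | ContDiff ℝ 2 f ∧ LipschitzWith 1 (iteratedDeriv 2 f)}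

/-- The class `𝓕₃^∞` of bounded members of `𝓕₃`. -/
def F3b : Set (ℝ → ℝ) :=
  {f | f ∈ F3 ∧ ∃ C : ℝ, ∀ x, |f x| ≤ C}

/-- Zolotarev's distance `ζ₃(P, Q) = sup {|Pf - Qf| : f ∈ 𝓕₃^∞}`, with values in `[0, ∞]`. -/
def zeta3 (P Q : Measure ℝ) : ℝ≥0∞ :=
  ⨆ f ∈ F3b, ENNReal.ofReal |(∫ x, f x ∂P) - ∫ x, f x ∂Q|

/-- The mean `μ(P)`. -/
def mean (P : Measure ℝ) : ℝ := ∫ x, x ∂P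

/-- The standard deviation `σ(P)`. -/
def sd (P : Measure ℝ) : ℝ := √(variance id P)

/-- The class `𝓟₃` of probability measures on `ℝ` with finite third absolute moment and
positive standard deviation. -/
def P3 : Set (Measure ℝ) :=
  {P | IsProbabilityMeasure P ∧ Integrable (fun x : ℝ => |x| ^ 3) P ∧ 0 < sd P}

/-- The standardization of `P`: its image under `x ↦ (x - μ(P)) / σ(P)`. -/
def standardize (P : Measure ℝ) : Measure ℝ :=
  P.map (fun x => (x - mean P) / sd P)

/-- The standardized third absolute moment `ρ(P)`. -/
def rho (P : Measure ℝ) : ℝ := ∫ x, |(x - mean P) / sd P| ^ 3 ∂P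

/-- The `n`-th convolution power `P^{*n}`. -/
def convPow (P : Measure ℝ) : ℕ → Measure ℝ
  | 0 => Measure.dirac 0
  | n + 1 => (convPow P n).conv P

/-- The symmetric binomial law `B_{n,1/2}`, the `n`-th convolution power of `(δ₀ + δ₁) / 2`. -/
def symBinomial (n : ℕ) : Measure ℝ :=
  convPow ((2⁻¹ : ℝ≥0∞) • Measure.dirac 0 + (2⁻¹ : ℝ≥0∞) • Measure.dirac 1) n

/-- The standard normal law. -/
def stdNormal : Measure ℝ := gaussianReal 0 1

/-- `ε_n`, the `ζ₃`-distance of the standardized symmetric binomial law to the normal law. -/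
def epsilon (n : ℕ) : ℝ≥0∞ := zeta3 (standardize (symBinomial n)) stdNormal

/-- The function `B` (meaningful on `[1, ∞)`). -/
def B (ρ : ℝ) : ℝ := √(ρ ^ 2 / 2 + ρ * √(ρ ^ 2 + 8) / 2 - 2)

/-- The weight `p_ρ` of the positive atom of `P_ρ` (meaningful for `ρ ≥ 1`). -/
def pRho (ρ : ℝ) : ℝ := 1 / 2 - 1 / 2 * √(ρ / 2 * √(ρ ^ 2 + 8) - ρ ^ 2 / 2 - 1)

/-- The two-point law `P_ρ = q δ_{-√(p/q)} + p δ_{√(q/p)}`, where `p = p_ρ` and `q = 1 - p`. -/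
def PRho (ρ : ℝ) : Measure ℝ :=
  ENNReal.ofReal (1 - pRho ρ) • Measure.dirac (-√(pRho ρ / (1 - pRho ρ))) +
    ENNReal.ofReal (pRho ρ) • Measure.dirac (√((1 - pRho ρ) / pRho ρ))

/-- The cubic test function `x ↦ x³ / 6`. -/
def cubic (x : ℝ) : ℝ := x ^ 3 / 6

end

end BerryEsseenZeta

open BerryEsseenZeta

namespace BerryEsseenZeta

/-! ### The classes `F3` and `F3b` -/

/-! The symmetric sign law, called `rademacher`, is put between a standardized law and the normal
law. The triangle inequality for `zeta3` then splits the error into a sharp leading term and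
`epsilon n`.

Leading term: for standard `μ` with third absolute moment `ρ`, the distance to `rademacher` is at
most `B ρ / 6`. On two-point laws on `{-a, 1/a}` this comes from quadratic interpolation, `x³/6`
being the worst test function. With `s = a + 1/a`, such a law has third absolute moment `s - 2/s`
and third moment of modulus `√(s² - 4)`, and `B` expresses the second through the first. General
laws reduce to two-point laws by duality: `f - d|·|³/6` with `d > 1` lies below a quadratic touching
it at both atoms of an optimal two-point law (`exists_quadratic_majorant`), and quadratics have the
same integral under all standard laws. Concavity of `B`, in the form of `exists_tangent_slope`,
allows `d` to be chosen as a tangent slope. Replacing the `n` summands one by one, each at scale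
`1/√n`, costs `n · n^(-3/2) · B/6`.

Remainder: `epsilon n = O(1/n)`, by replacing signs by normals one at a time. The normals already in
place smooth the test function; symmetry and equal variances leave a fourth-order error of relative
size `1/√j` at step `j` (`scaledClose_convPow_rademacher_gaussian`).

Optimality: third moments of centered laws add under convolution, so `x³/6` gives exactly `B ρ /
(6√n)` for `PRho ρ`. It is unbounded but is a limit of rescaled sines plus linear terms. Exactness
as `ρ → 1` follows from the triangle inequality in both directions, since `B` is continuous and `B 1
= 0`. -/

lemma hasDerivAt_of_mem_F3 {f : ℝ → ℝ} (hf : f ∈ F3) (x : ℝ) : HasDerivAt f (deriv f x) x :=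
  ((hf.1.differentiable (by norm_num)) x).hasDerivAt

lemma hasDerivAt_deriv_of_mem_F3 {f : ℝ → ℝ} (hf : f ∈ F3) (x : ℝ) :
    HasDerivAt (deriv f) (iteratedDeriv 2 f x) x := by
  have h : Differentiable ℝ (iteratedDeriv 1 f) :=
    hf.1.differentiable_iteratedDeriv 1 (by norm_num)
  rw [iteratedDeriv_succ, iteratedDeriv_one]
  rw [iteratedDeriv_one] at h
  exact (h x).hasDerivAt

lemma abs_iteratedDeriv_sub_le_of_mem_F3 {f : ℝ → ℝ} (hf : f ∈ F3) (x y : ℝ) :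
    |iteratedDeriv 2 f x - iteratedDeriv 2 f y| ≤ |x - y| := by
  simpa [Real.dist_eq] using hf.2.dist_le_mul x y

lemma mem_F3_of_hasDerivAt {f f' f'' : ℝ → ℝ} (h1 : ∀ x, HasDerivAt f (f' x) x)
    (h2 : ∀ x, HasDerivAt f' (f'' x) x) (h3 : ∀ x y, |f'' x - f'' y| ≤ |x - y|) : f ∈ F3 := by
  have e1 : deriv f = f' := funext fun x => (h1 x).deriv
  have e2 : deriv f' = f'' := funext fun x => (h2 x).deriv
  have e3 : iteratedDeriv 2 f = f'' := by
    rw [iteratedDeriv_succ, iteratedDeriv_one, e1, e2]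
  have hl : LipschitzWith 1 f'' := LipschitzWith.of_dist_le_mul fun x y => by
    simpa [Real.dist_eq] using h3 x y
  refine ⟨?_, by rwa [e3]⟩
  have : ContDiff ℝ (1 + 1) f := by
    rw [contDiff_succ_iff_deriv]
    refine ⟨fun x => (h1 x).differentiableAt, by simp, ?_⟩
    rw [e1, contDiff_one_iff_deriv]
    exact ⟨fun x => (h2 x).differentiableAt, by rw [e2]; exact hl.continuous⟩
  simpa [one_add_one_eq_two] using this

/-- Third-order homogeneity: an affine change of variable with slope `a` multiplies the Lipschitz
constant of the second derivative by `a³`. This is the source of every factor `a ^ 3` below. -/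
lemma F3b.comp_affine {f : ℝ → ℝ} (hf : f ∈ F3b) (w : ℝ) {a : ℝ} (ha : 0 < a) :
    (fun x => f (w + a * x) / a ^ 3) ∈ F3b := by
  obtain ⟨hf, C, hC⟩ := hf
  have hw : ∀ x, HasDerivAt (fun x => w + a * x) a x := fun x => by
    simpa using ((hasDerivAt_id x).const_mul a).const_add w
  refine ⟨mem_F3_of_hasDerivAt (f' := fun x => deriv f (w + a * x) / a ^ 2)
    (f'' := fun x => iteratedDeriv 2 f (w + a * x) / a) ?_ ?_ ?_, C / a ^ 3, ?_⟩
  · intro x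
    convert! ((hasDerivAt_of_mem_F3 hf (w + a * x)).comp x (hw x)).div_const (a ^ 3) using 1
    field_simp
  · intro x
    convert! ((hasDerivAt_deriv_of_mem_F3 hf (w + a * x)).comp x (hw x)).div_const (a ^ 2) using 1
    field_simp
  · intro x y
    have := abs_iteratedDeriv_sub_le_of_mem_F3 hf (w + a * x) (w + a * y)
    rw [← sub_div, abs_div, abs_of_pos ha, div_le_iff₀ ha]
    calc _ ≤ _ := this
      _ = |x - y| * a := by
        rw [add_sub_add_left_eq_sub, ← mul_sub, abs_mul, abs_of_pos ha, mul_comm]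
  · intro x
    rw [abs_div, abs_of_pos (pow_pos ha 3)]
    gcongr
    exact hC _

lemma F3.neg {f : ℝ → ℝ} (hf : f ∈ F3) : (fun x => -f x) ∈ F3 := by
  refine mem_F3_of_hasDerivAt (fun x => (hasDerivAt_of_mem_F3 hf x).neg)
    (fun x => (hasDerivAt_deriv_of_mem_F3 hf x).neg) fun x y => ?_
  rw [neg_sub_neg, abs_sub_comm]
  exact abs_iteratedDeriv_sub_le_of_mem_F3 hf x y

lemma F3.comp_neg {f : ℝ → ℝ} (hf : f ∈ F3) : (fun x => f (-x)) ∈ F3 := by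
  refine mem_F3_of_hasDerivAt (f' := fun x => -deriv f (-x))
    (f'' := fun x => iteratedDeriv 2 f (-x)) (fun x => ?_) (fun x => ?_) fun x y => ?_
  · convert! (hasDerivAt_of_mem_F3 hf (-x)).comp x (hasDerivAt_neg x) using 1; ring
  · convert! ((hasDerivAt_deriv_of_mem_F3 hf (-x)).comp x (hasDerivAt_neg x)).neg using 1; ring
  · have := abs_iteratedDeriv_sub_le_of_mem_F3 hf (-x) (-y)
    rwa [neg_sub_neg, abs_sub_comm y x] at this

lemma F3b.neg {f : ℝ → ℝ} (hf : f ∈ F3b) : (fun x => -f x) ∈ F3b :=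
  ⟨F3.neg hf.1, hf.2.imp fun C hC x => by simpa using hC x⟩

lemma F3.continuous {f : ℝ → ℝ} (hf : f ∈ F3) : Continuous f := hf.1.continuous

lemma cubic_mem_F3 : cubic ∈ F3 := by
  refine mem_F3_of_hasDerivAt (f' := fun x => x ^ 2 / 2) (f'' := fun x => x)
    (fun x => ?_) (fun x => ?_) fun x y => le_rfl
  · convert! (hasDerivAt_pow 3 x).div_const 6 using 1; norm_num; ring
  · convert! (hasDerivAt_pow 2 x).div_const 2 using 1; norm_num

/-- Rescaled sines are bounded members of `F3`. -/
lemma neg_cube_mul_sin_mem_F3b {m : ℝ} (hm : 0 < m) :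
    (fun x => -(m ^ 3 * Real.sin (x / m))) ∈ F3b := by
  have hd : ∀ x : ℝ, HasDerivAt (fun x => x / m) (1 / m) x := fun x => (hasDerivAt_id x).div_const m
  refine ⟨mem_F3_of_hasDerivAt (f' := fun x => -(m ^ 2 * Real.cos (x / m)))
    (f'' := fun x => m * Real.sin (x / m)) (fun x => ?_) (fun x => ?_) fun x y => ?_, m ^ 3,
    fun x => ?_⟩
  · convert! (((hd x).sin).const_mul (m ^ 3)).neg using 1; field_simp
  · convert! (((hd x).cos).const_mul (m ^ 2)).neg using 1; field_simp
  · have := Real.abs_sin_sub_sin_le (x / m) (y / m)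
    rw [← mul_sub, abs_mul, abs_of_pos hm]
    rw [← sub_div, abs_div, abs_of_pos hm, le_div_iff₀ hm] at this
    linarith
  · rw [abs_neg, abs_mul, abs_of_pos (pow_pos hm 3)]
    exact mul_le_of_le_one_right (pow_pos hm 3).le (Real.abs_sin_le_one _)

/-! ### Two-point inequalities from the sign pattern of the second derivative -/

/-- Two applications of the mean value theorem, so `g''` need not be continuous. Only the sign of
the weight `θ` is needed, not the Taylor value `(t - x)² / 2`. -/
lemma exists_taylor_of_deriv_eq_zero {g g' g'' : ℝ → ℝ} (h1 : ∀ x, HasDerivAt g (g' x) x)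
    (h2 : ∀ x, HasDerivAt g' (g'' x) x) {x : ℝ} (hx : g' x = 0) (t : ℝ) :
    ∃ e θ : ℝ, min x t ≤ e ∧ e ≤ max x t ∧ 0 ≤ θ ∧ g t = g x + g'' e * θ := by
  rcases lt_trichotomy t x with h | rfl | h
  · obtain ⟨c, ⟨hc1, hc2⟩, hc⟩ := exists_hasDerivAt_eq_slope g g' h
      (fun y _ => (h1 y).continuousAt.continuousWithinAt) (fun y _ => h1 y)
    obtain ⟨e, ⟨he1, he2⟩, he⟩ := exists_hasDerivAt_eq_slope g' g'' hc2
      (fun y _ => (h2 y).continuousAt.continuousWithinAt) (fun y _ => h2 y)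
    rw [eq_div_iff (by linarith)] at hc he
    refine ⟨e, (x - c) * (x - t), by simp; right; linarith, by simp; left; linarith,
      mul_nonneg (by linarith) (by linarith), ?_⟩
    rw [← mul_assoc, he, hx]; linarith
  · exact ⟨t, 0, by simp, by simp, le_rfl, by simp⟩
  · obtain ⟨c, ⟨hc1, hc2⟩, hc⟩ := exists_hasDerivAt_eq_slope g g' h
      (fun y _ => (h1 y).continuousAt.continuousWithinAt) (fun y _ => h1 y)
    obtain ⟨e, ⟨he1, he2⟩, he⟩ := exists_hasDerivAt_eq_slope g' g'' hc1
      (fun y _ => (h2 y).continuousAt.continuousWithinAt) (fun y _ => h2 y)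
    rw [eq_div_iff (by linarith)] at hc he
    refine ⟨e, (c - x) * (t - x), by simp; left; linarith, by simp; right; linarith,
      mul_nonneg (by linarith) (by linarith), ?_⟩
    rw [← mul_assoc, he, hx]; linarith

/-- A function with two double zeros whose second derivative is strictly increasing up to `0`
and strictly decreasing from `0` on is nonpositive. -/
lemma nonpos_of_double_zeros {g g' g'' : ℝ → ℝ} (h1 : ∀ x, HasDerivAt g (g' x) x)
    (h2 : ∀ x, HasDerivAt g' (g'' x) x) (hmono : StrictMonoOn g'' (Set.Iic 0))
    (hanti : StrictAntiOn g'' (Set.Ici 0)) {x y : ℝ} (hxy : x < y) (hgx : g x = 0) (hgy : g y = 0)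
    (hgx' : g' x = 0) (hgy' : g' y = 0) (t : ℝ) : g t ≤ 0 := by
  have hc : ∀ z, ContinuousAt g z := fun z => (h1 z).continuousAt
  have hc' : ∀ z, ContinuousAt g' z := fun z => (h2 z).continuousAt
  -- Rolle, applied to `g` and then twice to `g'`, gives zeros `u < v` of `g''` strictly between `x`
  -- and `y`. As `g''` is unimodal, it is nonpositive outside `[u, v]` and nonnegative inside.
  obtain ⟨z, ⟨hz1, hz2⟩, hz⟩ := exists_hasDerivAt_eq_zero hxy
    (fun z _ => (hc z).continuousWithinAt) (by rw [hgx, hgy]) (fun z _ => h1 z)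
  obtain ⟨u, ⟨hu1, hu2⟩, hu⟩ := exists_hasDerivAt_eq_zero hz1
    (fun z _ => (hc' z).continuousWithinAt) (by rw [hgx', hz]) (fun z _ => h2 z)
  obtain ⟨v, ⟨hv1, hv2⟩, hv⟩ := exists_hasDerivAt_eq_zero hz2
    (fun z _ => (hc' z).continuousWithinAt) (by rw [hgy', hz]) (fun z _ => h2 z)
  have key : ∀ a b c : ℝ, a < b → b < c → g'' a < g'' b ∨ g'' c < g'' b := fun a b c hab hbc => by
    rcases le_total b 0 with hb | hb
    · exact Or.inl (hmono (by simp; linarith) (by simpa using hb) hab)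
    · exact Or.inr (hanti (by simpa using hb) (by simp; linarith) hbc)
  have huv : u < v := by linarith
  have hlow : ∀ e ≤ u, g'' e ≤ 0 := fun e he => by
    rcases he.lt_or_eq with he | rfl
    · rcases key e u v he huv with h | h <;> linarith
    · exact hu.le
  have hup : ∀ e ≥ v, g'' e ≤ 0 := fun e he => by
    rcases he.lt_or_eq with he | rfl
    · rcases key u v e huv he with h | h <;> linarith
    · exact hv.le
  have hmid : ∀ e, u ≤ e → e ≤ v → 0 ≤ g'' e := fun e he1 he2 => by
    rcases he1.lt_or_eq with he1 | rfl
    · rcases he2.lt_or_eq with he2 | rfl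
      · rcases key u e v he1 he2 with h | h <;> linarith
      · exact hv.ge
    · exact hu.ge
  have hA : ∀ t ≤ u, g t ≤ 0 := fun t ht => by
    obtain ⟨e, θ, -, he, hθ, h⟩ := exists_taylor_of_deriv_eq_zero h1 h2 hgx' t
    rw [h, hgx, zero_add]
    exact mul_nonpos_of_nonpos_of_nonneg (hlow e (he.trans (max_le hu1.le ht))) hθ
  have hB : ∀ t ≥ v, g t ≤ 0 := fun t ht => by
    obtain ⟨e, θ, he, -, hθ, h⟩ := exists_taylor_of_deriv_eq_zero h1 h2 hgy' t
    rw [h, hgy, zero_add]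
    exact mul_nonpos_of_nonpos_of_nonneg (hup e ((le_min hv2.le ht).trans he)) hθ
  rcases le_total t u with ht | ht
  · exact hA t ht
  rcases le_total v t with ht' | ht'
  · exact hB t ht'
  -- Between `u` and `v` the function is convex, hence below the larger of its endpoint values, and
  -- these are already known to be nonpositive.
  have hconv : ConvexOn ℝ (Set.Icc u v) g := by
    refine convexOn_of_hasDerivWithinAt2_nonneg (convex_Icc u v)
      (fun z _ => (hc z).continuousWithinAt) (fun z _ => (h1 z).hasDerivWithinAt)
      (fun z _ => (h2 z).hasDerivWithinAt) fun z hz => ?_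
    rw [interior_Icc] at hz
    exact hmid z hz.1.le hz.2.le
  refine (hconv.le_max_of_mem_Icc (Set.left_mem_Icc.2 huv.le) (Set.right_mem_Icc.2 huv.le)
    ⟨ht, ht'⟩).trans (max_le (hA u le_rfl) (hB v le_rfl))

/-- If the second derivative is monotone, then passing from the symmetric two-point law on
`{-1, 1}` to the standardized two-point law on `{-a, 1 / a}` with `a ≤ 1` increases integrals. -/
lemma symm_le_twoPoint_of_monotone {g g' g'' : ℝ → ℝ} (h1 : ∀ x, HasDerivAt g (g' x) x)
    (h2 : ∀ x, HasDerivAt g' (g'' x) x) (hmono : Monotone g'') {a : ℝ} (ha : 0 < a) (ha1 : a ≤ 1) :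
    (g 1 + g (-1)) / 2 ≤ (g (-a) + a ^ 2 * g (1 / a)) / (1 + a ^ 2) := by
  rcases ha1.lt_or_eq with ha1 | rfl
  swap
  · norm_num; linarith
  -- Newton coefficients of the quadratic interpolating `g` at `-1`, `-a` and `1`, which are
  -- distinct since now `a < 1`. The remainder `r` has three zeros, so Rolle gives a zero of `r''`;
  -- monotonicity of `r''` then makes `r` nondecreasing to the right of `v`.
  obtain ⟨b, c, hb, hc⟩ : ∃ b c : ℝ, g (-1) + b * (1 - a) = g (-a) ∧
      g (-1) + b * 2 + c * 2 * (1 + a) = g 1 := by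
    have : (1 - a) ≠ 0 := by linarith
    refine ⟨(g (-a) - g (-1)) / (1 - a),
      (g 1 - g (-1) - (g (-a) - g (-1)) / (1 - a) * 2) / (2 * (1 + a)), ?_, ?_⟩
    · field_simp; ring
    · field_simp; ring
  let r : ℝ → ℝ := fun t => g t - (g (-1) + b * (t + 1) + c * ((t + 1) * (t + a)))
  let r' : ℝ → ℝ := fun t => g' t - (b + c * (2 * t + 1 + a))
  let r'' : ℝ → ℝ := fun t => g'' t - c * 2
  have hr1 : ∀ t, HasDerivAt r (r' t) t := fun t => by
    have hid := hasDerivAt_id t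
    convert! (h1 t).sub ((((hid.add_const (1 : ℝ)).const_mul b).const_add (g (-1))).add
      (((hid.add_const (1 : ℝ)).mul (hid.add_const a)).const_mul c)) using 1
    simp only [r', id_eq]; ring
  have hr2 : ∀ t, HasDerivAt r' (r'' t) t := fun t => by
    have hid := hasDerivAt_id t
    convert! (h2 t).sub (((((hid.const_mul 2).add_const (1 : ℝ)).add_const a).const_mul c).const_add
      b) using 1
    simp [r'']
  have hz1 : r (-1) = 0 := by simp [r]
  have hz2 : r (-a) = 0 := by simp only [r]; linear_combination -hb
  have hz3 : r 1 = 0 := by simp only [r]; linear_combination -hc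
  have hcr : ∀ z, ContinuousAt r z := fun z => (hr1 z).continuousAt
  have hcr' : ∀ z, ContinuousAt r' z := fun z => (hr2 z).continuousAt
  obtain ⟨u, ⟨hu1, hu2⟩, hu⟩ := exists_hasDerivAt_eq_zero (show (-1 : ℝ) < -a by linarith)
    (fun z _ => (hcr z).continuousWithinAt) (by rw [hz1, hz2]) (fun z _ => hr1 z)
  obtain ⟨v, ⟨hv1, hv2⟩, hv⟩ := exists_hasDerivAt_eq_zero (show -a < 1 by linarith)
    (fun z _ => (hcr z).continuousWithinAt) (by rw [hz2, hz3]) (fun z _ => hr1 z)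
  obtain ⟨e, ⟨he1, he2⟩, he⟩ := exists_hasDerivAt_eq_zero (show u < v by linarith)
    (fun z _ => (hcr' z).continuousWithinAt) (by rw [hu, hv]) (fun z _ => hr2 z)
  have hpos : ∀ t ≥ v, 0 ≤ r'' t := fun t ht => by
    rw [← he]; simp only [r'']; linarith [hmono (show e ≤ t by linarith)]
  have hrm : MonotoneOn r' (Set.Ici v) := by
    refine monotoneOn_of_deriv_nonneg (convex_Ici v) (fun z _ => (hcr' z).continuousWithinAt)
      (fun z _ => (hr2 z).differentiableAt.differentiableWithinAt) fun z hz => ?_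
    rw [(hr2 z).deriv]; exact hpos z (interior_subset hz)
  have hrm2 : MonotoneOn r (Set.Ici v) := by
    refine monotoneOn_of_deriv_nonneg (convex_Ici v) (fun z _ => (hcr z).continuousWithinAt)
      (fun z _ => (hr1 z).differentiableAt.differentiableWithinAt) fun z hz => ?_
    rw [(hr1 z).deriv, ← hv]
    exact hrm (by simp) (interior_subset hz) (interior_subset hz)
  have ha' : 1 ≤ 1 / a := by rw [le_div_iff₀ ha]; linarith
  have hfin : 0 ≤ r (1 / a) := by
    rw [← hz3]; exact hrm2 (by simpa using hv2.le) (by simp at ha' ⊢; linarith) ha'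
  have e1 : g (1 / a) = r (1 / a) + (g (-1) + b * (1 / a + 1) + c * ((1 / a + 1) * (1 / a + a))) := by
    simp only [r]; ring
  -- Both laws have mean `0` and variance `1`, so the quadratic contributes equally to both sides.
  -- Of the nodes involved, `r` can be nonzero only at `1 / a`.
  have e2 : (g (-a) + a ^ 2 * g (1 / a)) / (1 + a ^ 2)
      = (g 1 + g (-1)) / 2 + a ^ 2 / (1 + a ^ 2) * r (1 / a) := by
    rw [e1, ← hb, ← hc]; field_simp; ring
  rw [e2]
  have : 0 ≤ a ^ 2 / (1 + a ^ 2) * r (1 / a) := by positivity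
  linarith

/-- Since `f''` is 1-Lipschitz, `x³/6 - f` has monotone second derivative. The right side is the
integral of `x³/6` under the two-point law; under the symmetric law that integral is zero. -/
lemma twoPoint_sub_symm_le_of_le_one {f : ℝ → ℝ} (hf : f ∈ F3) {a : ℝ} (ha : 0 < a) (ha1 : a ≤ 1) :
    (f (-a) + a ^ 2 * f (1 / a)) / (1 + a ^ 2) - (f 1 + f (-1)) / 2 ≤ (1 / a - a) / 6 := by
  have := symm_le_twoPoint_of_monotone (g := fun x => x ^ 3 / 6 - f x)
    (g' := fun x => x ^ 2 / 2 - deriv f x) (g'' := fun x => x - iteratedDeriv 2 f x)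
    (fun x => by
      refine HasDerivAt.sub ?_ (hasDerivAt_of_mem_F3 hf x)
      convert! (hasDerivAt_pow 3 x).div_const 6 using 1; norm_num; ring)
    (fun x => by
      refine HasDerivAt.sub ?_ (hasDerivAt_deriv_of_mem_F3 hf x)
      convert! (hasDerivAt_pow 2 x).div_const 2 using 1; norm_num)
    (fun x y hxy => by
      have := (le_abs_self _).trans (abs_iteratedDeriv_sub_le_of_mem_F3 hf y x)
      rw [abs_of_nonneg (by linarith)] at this
      simp only; linarith) ha ha1
  have e : ((-a) ^ 3 / 6 - f (-a) + a ^ 2 * ((1 / a) ^ 3 / 6 - f (1 / a))) / (1 + a ^ 2)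
      = (1 / a - a) / 6 - (f (-a) + a ^ 2 * f (1 / a)) / (1 + a ^ 2) := by
    field_simp; ring
  simp only [e] at this
  norm_num at this ⊢
  linarith

lemma twoPoint_sub_symm_le {f : ℝ → ℝ} (hf : f ∈ F3) {a : ℝ} (ha : 0 < a) :
    (f (-a) + a ^ 2 * f (1 / a)) / (1 + a ^ 2) - (f 1 + f (-1)) / 2 ≤ |1 / a - a| / 6 := by
  rcases le_total a 1 with h | h
  · refine (twoPoint_sub_symm_le_of_le_one hf ha h).trans ?_
    gcongr; exact le_abs_self _
  · have h' := twoPoint_sub_symm_le_of_le_one (F3.comp_neg hf) (a := 1 / a) (by positivity)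
      (by rw [div_le_iff₀ ha]; linarith)
    have e : (f (-a) + a ^ 2 * f (1 / a)) / (1 + a ^ 2)
        = (f (- -(1 / a)) + (1 / a) ^ 2 * f (-(1 / (1 / a)))) / (1 + (1 / a) ^ 2) := by
      rw [neg_neg, one_div_one_div]; field_simp; ring
    rw [e]
    have e2 : |1 / a - a| = 1 / (1 / a) - 1 / a := by
      rw [one_div_one_div, abs_sub_comm, abs_of_nonneg]
      have : 1 / a ≤ 1 := by rw [div_le_iff₀ ha]; linarith
      linarith
    rw [e2]
    simp only [neg_neg] at h' ⊢
    linarith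

/-! ### Integrals against standardized laws are bounded through two-point laws -/

lemma hasDerivAt_mul_abs (x : ℝ) : HasDerivAt (fun x : ℝ => x * |x|) (2 * |x|) x := by
  rcases lt_trichotomy x 0 with h | rfl | h
  · have : HasDerivAt (fun x : ℝ => -x ^ 2) (2 * |x|) x := by
      convert! (hasDerivAt_pow 2 x).neg using 1
      rw [abs_of_neg h]; norm_num
    refine this.congr_of_eventuallyEq ?_
    filter_upwards [Iio_mem_nhds h] with y hy
    rw [abs_of_neg hy]; ring
  · rw [hasDerivAt_iff_tendsto_slope]
    have : Tendsto (fun y : ℝ => |y|) (𝓝[≠] 0) (𝓝 (2 * |0|)) := by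
      have h := (continuous_abs (G := ℝ)).tendsto 0
      simp only [abs_zero, mul_zero] at h ⊢
      exact h.mono_left nhdsWithin_le_nhds
    refine this.congr' ?_
    filter_upwards [self_mem_nhdsWithin] with y hy
    rw [slope_def_field]
    have : y ≠ 0 := hy
    field_simp; simp
  · have : HasDerivAt (fun x : ℝ => x ^ 2) (2 * |x|) x := by
      convert! hasDerivAt_pow 2 x using 1
      rw [abs_of_pos h]; norm_num
    refine this.congr_of_eventuallyEq ?_
    filter_upwards [Ioi_mem_nhds h] with y hy
    rw [abs_of_pos hy]; ring

lemma hasDerivAt_abs_cube (x : ℝ) : HasDerivAt (fun x : ℝ => |x| ^ 3) (3 * (x * |x|)) x := by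
  have : (fun x : ℝ => |x| ^ 3) = fun x => x * (x * |x|) := by
    funext y
    rw [← mul_assoc, ← sq, ← sq_abs]; ring
  rw [this]
  convert! (hasDerivAt_id x).mul (hasDerivAt_mul_abs x) using 1
  simp only [id]; ring

/-- The integral of `g` against the standardized two-point law on `{-a, 1 / a}`. -/
noncomputable def twoPointAvg (g : ℝ → ℝ) (a : ℝ) : ℝ :=
  (g (-a) + a ^ 2 * g (1 / a)) / (1 + a ^ 2)

/-- With `s = a + 1/a`, the third absolute moment of the two-point law is `s - 2/s`. -/
lemma twoPointAvg_penalized {f : ℝ → ℝ} {d a : ℝ} (ha : 0 < a) :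
    twoPointAvg (fun t => f t - d * |t| ^ 3 / 6) a
      = twoPointAvg f a - d * ((a + 1 / a) - 2 / (a + 1 / a)) / 6 := by
  have h1 : |1 / a| = 1 / a := abs_of_pos (by positivity)
  simp only [twoPointAvg, abs_neg, abs_of_pos ha, h1]
  field_simp; ring

/-- As `s = b + 1/b` grows, the average of `f` gains at most about `s/6` while the penalty grows
like `d s/6`. Hence `d > 1` confines the maximization to a compact interval. -/
lemma exists_twoPointAvg_max {f : ℝ → ℝ} (hf : f ∈ F3) {d : ℝ} (hd : 1 < d) :
    ∃ a > 0, ∀ b > 0, twoPointAvg (fun t => f t - d * |t| ^ 3 / 6) b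
      ≤ twoPointAvg (fun t => f t - d * |t| ^ 3 / 6) a := by
  set φ : ℝ → ℝ := fun t => f t - d * |t| ^ 3 / 6 with hφ
  have hφc : Continuous φ := by have := F3.continuous hf; fun_prop
  -- For `s ≥ 2d/(d - 1)` the bound `s - d(s - 1) ≤ -d` shows that `b` does no better than the
  -- symmetric law `b = 1`.
  set K : ℝ := 2 * d / (d - 1) + 1 with hK
  have hd1 : 0 < d - 1 := by linarith
  have hK1 : 1 < K := by have : 0 < 2 * d / (d - 1) := by positivity
                         linarith
  have hK0 : 0 < K := by linarith
  have hKi : 1 / K < 1 := by rw [div_lt_iff₀ hK0]; linarith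
  have hcont : ContinuousOn (twoPointAvg φ) (Set.Icc (1 / K) K) := by
    have hne : ∀ x ∈ Set.Icc (1 / K) K, x ≠ 0 := fun x hx =>
      ((by positivity : 0 < 1 / K).trans_le hx.1).ne'
    have hinv : ContinuousOn (fun x : ℝ => 1 / x) (Set.Icc (1 / K) K) :=
      continuousOn_const.div continuousOn_id hne
    have h2 : ContinuousOn (fun x : ℝ => φ (1 / x)) (Set.Icc (1 / K) K) :=
      hφc.comp_continuousOn hinv
    have h3 : Continuous fun x : ℝ => φ (-x) := hφc.comp continuous_neg
    exact (h3.continuousOn.add ((continuous_pow 2).continuousOn.mul h2)).div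
      (by fun_prop) fun x _ => by positivity
  obtain ⟨a, ⟨ha1, ha2⟩, hmax⟩ := isCompact_Icc.exists_isMaxOn
    ⟨1, hKi.le, hK1.le⟩ hcont
  refine ⟨a, (by positivity : 0 < 1 / K).trans_le ha1, fun b hb => ?_⟩
  by_cases hbK : b ∈ Set.Icc (1 / K) K
  · exact hmax hbK
  refine le_trans ?_ (hmax (⟨hKi.le, hK1.le⟩ : (1 : ℝ) ∈ Set.Icc (1 / K) K))
  have hs : K < b + 1 / b := by
    have hb' : 0 < 1 / b := by positivity
    rw [Set.mem_Icc, not_and_or, not_le, not_le] at hbK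
    rcases hbK with h | h
    · have : K < 1 / b := by rwa [lt_div_iff₀ hb, mul_comm, ← lt_div_iff₀ hK0]
      linarith
    · linarith
  rw [twoPointAvg_penalized hb, twoPointAvg_penalized one_pos]
  have h1 := twoPoint_sub_symm_le hf hb
  have h2 : |1 / b - b| ≤ b + 1 / b := by
    have hb' : 0 < 1 / b := by positivity
    rw [abs_le]; constructor <;> linarith
  have h3 : 2 / (b + 1 / b) ≤ 1 := by
    rw [div_le_iff₀ (by linarith)]
    have : 0 ≤ (b - 1) ^ 2 / b := by positivity
    have e : (b - 1) ^ 2 / b = b + 1 / b - 2 := by field_simp; ring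
    linarith
  have h4 : 2 * d < (d - 1) * (b + 1 / b) := by
    have : 2 * d / (d - 1) < b + 1 / b := by linarith
    rw [div_lt_iff₀ hd1] at this
    linarith
  have e1 : twoPointAvg f 1 = (f 1 + f (-1)) / 2 := by simp [twoPointAvg]; norm_num; ring
  rw [e1]
  change twoPointAvg f b - _ ≤ _ at h1
  have e2 : (1 : ℝ) + 1 / 1 - 2 / (1 + 1 / 1) = 1 := by norm_num
  rw [e2]
  linarith [mul_le_mul_of_nonneg_left h3 (by linarith : 0 ≤ d)]

/-- The penalized function `f - d |·|³ / 6` lies below a quadratic polynomial whose integral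
against standardized laws is attained at a two-point law. -/
lemma exists_quadratic_majorant {f : ℝ → ℝ} (hf : f ∈ F3) {d : ℝ} (hd : 1 < d) :
    ∃ a > 0, ∃ A B C : ℝ, (∀ t, f t - d * |t| ^ 3 / 6 ≤ A + B * t + C * t ^ 2) ∧
      A + C = twoPointAvg (fun t => f t - d * |t| ^ 3 / 6) a := by
  obtain ⟨a, ha, hmax⟩ := exists_twoPointAvg_max hf hd
  refine ⟨a, ha, ?_⟩
  set φ : ℝ → ℝ := fun t => f t - d * |t| ^ 3 / 6 with hφ
  set φ' : ℝ → ℝ := fun t => deriv f t - d * (t * |t|) / 2 with hφ'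
  set φ'' : ℝ → ℝ := fun t => iteratedDeriv 2 f t - d * |t| with hφ''
  have h1 : ∀ t, HasDerivAt φ (φ' t) t := fun t => by
    convert! (hasDerivAt_of_mem_F3 hf t).sub (((hasDerivAt_abs_cube t).const_mul d).div_const 6)
      using 1
    simp only [hφ']; ring
  have h2 : ∀ t, HasDerivAt φ' (φ'' t) t := fun t => by
    convert! (hasDerivAt_deriv_of_mem_F3 hf t).sub
      (((hasDerivAt_mul_abs t).const_mul d).div_const 2) using 1
    simp only [hφ'']; ring
  have hmono : StrictMonoOn φ'' (Set.Iic 0) := fun x hx y hy hxy => by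
    have := (le_abs_self _).trans (abs_iteratedDeriv_sub_le_of_mem_F3 hf x y)
    rw [abs_of_neg (by linarith : x - y < 0)] at this
    simp only [hφ'', abs_of_nonpos (Set.mem_Iic.1 hx), abs_of_nonpos (Set.mem_Iic.1 hy)]
    nlinarith
  have hanti : StrictAntiOn φ'' (Set.Ici 0) := fun x hx y hy hxy => by
    have := (le_abs_self _).trans (abs_iteratedDeriv_sub_le_of_mem_F3 hf y x)
    rw [abs_of_pos (by linarith : 0 < y - x)] at this
    simp only [hφ'', abs_of_nonneg (Set.mem_Ici.1 hx), abs_of_nonneg (Set.mem_Ici.1 hy)]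
    nlinarith
  set M := twoPointAvg φ a with hM
  have ha2 : 0 < 1 + a ^ 2 := by positivity
  have hMe : M * (1 + a ^ 2) = φ (-a) + a ^ 2 * φ (1 / a) := by
    rw [hM, twoPointAvg]; field_simp
  -- Clearing the denominator `1 + b²` keeps `a` a maximum, now with value `0`, and makes the
  -- stationarity condition polynomial in `a` and the values of `φ`, `φ'`.
  have hext : IsLocalMax (fun b => φ (-b) + b ^ 2 * φ (1 / b) - M * (1 + b ^ 2)) a := by
    filter_upwards [Ioi_mem_nhds ha] with b hb
    have h := hmax b hb
    rw [twoPointAvg, div_le_iff₀ (by positivity)] at h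
    rw [← hMe]; linarith
  have hder : HasDerivAt (fun b => φ (-b) + b ^ 2 * φ (1 / b) - M * (1 + b ^ 2))
      (-φ' (-a) + (2 * a * φ (1 / a) - φ' (1 / a)) - M * (2 * a)) a := by
    have e1 : HasDerivAt (fun b => φ (-b)) (-φ' (-a)) a := by
      convert! (h1 (-a)).comp a (hasDerivAt_neg a) using 1; ring
    have e2 : HasDerivAt (fun b => φ (1 / b)) (φ' (1 / a) * (-1 / a ^ 2)) a := by
      have hi : HasDerivAt (fun b : ℝ => 1 / b) (-1 / a ^ 2) a := by
        convert! hasDerivAt_inv ha.ne' using 1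
        · funext b; simp
        · field_simp
      exact (h1 (1 / a)).comp a hi
    have e3 : HasDerivAt (fun b : ℝ => b ^ 2) (2 * a) a := by simpa using hasDerivAt_pow 2 a
    convert! (e1.add (e3.mul e2)).sub ((e3.const_add 1).const_mul M) using 1
    field_simp; ring
  have hz := hext.hasDerivAt_eq_zero hder
  set L := 1 / a + a with hL
  have hL0 : 0 < L := by positivity
  -- The quadratic is fixed by value and slope at `-a` and by its value at `1/a`. That its slope at
  -- `1/a` also agrees is exactly stationarity of `a`; so the difference has two double zeros.
  set γ := (φ (1 / a) - φ (-a) - φ' (-a) * L) / L ^ 2 with hγ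
  have hγe : φ (-a) + φ' (-a) * L + γ * L ^ 2 = φ (1 / a) := by
    rw [hγ]; field_simp; ring
  have hslope : φ' (-a) + 2 * γ * L = φ' (1 / a) := by
    have hγL : 2 * γ * L = 2 * (φ (1 / a) - φ (-a)) / L - 2 * φ' (-a) := by
      rw [hγ]; field_simp
    have haL : 1 + a ^ 2 = a * L := by rw [hL]; field_simp
    have hMa : 2 * a * (φ (1 / a) - M) = 2 * (φ (1 / a) - φ (-a)) / L := by
      rw [eq_div_iff hL0.ne']
      linear_combination -2 * hMe + 2 * (M - φ (1 / a)) * haL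
    rw [hγL]; linarith
  refine ⟨φ (-a) + φ' (-a) * a + γ * a ^ 2, φ' (-a) + 2 * γ * a, γ, fun t => ?_, ?_⟩
  · have key := nonpos_of_double_zeros
      (g := fun t => φ t - (φ (-a) + φ' (-a) * (t + a) + γ * (t + a) ^ 2))
      (g' := fun t => φ' t - (φ' (-a) + 2 * γ * (t + a)))
      (g'' := fun t => φ'' t - 2 * γ) (x := -a) (y := 1 / a)
      (fun t => by
        have hid := (hasDerivAt_id t).add_const a
        convert! (h1 t).sub (((hid.const_mul (φ' (-a))).const_add (φ (-a))).add
          ((hid.pow 2).const_mul γ)) using 1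
        simp only [id]; norm_num; ring)
      (fun t => by
        have hid := (hasDerivAt_id t).add_const a
        convert! (h2 t).sub ((hid.const_mul (2 * γ)).const_add (φ' (-a))) using 1
        ring)
      (fun x hx y hy hxy => by simpa using hmono hx hy hxy)
      (fun x hx y hy hxy => by simpa using hanti hx hy hxy)
      (by have : 0 < 1 / a := by positivity
          linarith)
      (by simp) (by simp only [← hL]; linarith) (by simp) (by simp only [← hL]; linarith) t
    have : φ t ≤ φ (-a) + φ' (-a) * (t + a) + γ * (t + a) ^ 2 := by linarith
    calc _ ≤ _ := this
      _ = _ := by ring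
  · have haL : 1 + a ^ 2 = a * L := by rw [hL]; field_simp
    have hLa : L - a = 1 / a := by rw [hL]; ring
    have : (φ (-a) + φ' (-a) * a + γ * a ^ 2 + γ) * (1 + a ^ 2) = M * (1 + a ^ 2) := by
      rw [hMe, ← hγe, hL]; field_simp; ring
    exact mul_right_cancel₀ ha2.ne' this

/-- Weak duality: integrating the quadratic majorant depends only on the mean and variance, so `μ`
is compared with the optimal two-point law at the price of `d` times the gap in third absolute
moments. -/
lemma integral_sub_symm_le_of_penalty {μ : Measure ℝ} [IsProbabilityMeasure μ]
    (hm1 : ∫ x, x ∂μ = 0) (hm2 : ∫ x, x ^ 2 ∂μ = 1)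
    (hi1 : Integrable (fun x => x) μ) (hi2 : Integrable (fun x => x ^ 2) μ)
    (hi3 : Integrable (fun x => |x| ^ 3) μ) {f : ℝ → ℝ} (hf : f ∈ F3b) {d : ℝ} (hd : 1 < d) :
    ∃ a > 0, ∫ x, f x ∂μ - (f 1 + f (-1)) / 2 ≤ (|1 / a - a|
      + d * ((∫ x, |x| ^ 3 ∂μ) - ((a + 1 / a) - 2 / (a + 1 / a)))) / 6 := by
  obtain ⟨a, ha, A, B, C, hle, hAC⟩ := exists_quadratic_majorant hf.1 hd
  refine ⟨a, ha, ?_⟩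
  obtain ⟨hf3, K, hK⟩ := hf
  have hif : Integrable f μ := Integrable.of_bound (F3.continuous hf3).aestronglyMeasurable K
    (ae_of_all _ fun x => by simpa using hK x)
  have hq : ∫ x, (A + B * x + C * x ^ 2) ∂μ = A + C := by
    have hlin : Integrable (fun x => A + B * x) μ := (integrable_const A).add (hi1.const_mul B)
    rw [integral_add hlin (hi2.const_mul C),
      integral_add (integrable_const A) (hi1.const_mul B), integral_const_mul, integral_const_mul,
      hm1, hm2]
    simp
  have hint : ∫ x, (f x - d * |x| ^ 3 / 6) ∂μ = ∫ x, f x ∂μ - d * (∫ x, |x| ^ 3 ∂μ) / 6 := by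
    rw [integral_sub hif ((hi3.const_mul d).div_const 6), integral_div, integral_const_mul]
  have hmono : ∫ x, (f x - d * |x| ^ 3 / 6) ∂μ ≤ ∫ x, (A + B * x + C * x ^ 2) ∂μ :=
    integral_mono (hif.sub ((hi3.const_mul d).div_const 6))
      (((integrable_const A).add (hi1.const_mul B)).add (hi2.const_mul C)) hle
  rw [hq, hAC, hint, twoPointAvg_penalized ha] at hmono
  have := twoPoint_sub_symm_le hf3 ha
  change twoPointAvg f a - _ ≤ _ at this
  linarith

/-! ### The function `B` -/

lemma two_le_add_inv {a : ℝ} (ha : 0 < a) : 2 ≤ a + 1 / a := by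
  have : 0 ≤ (a - 1) ^ 2 / a := by positivity
  have e : (a - 1) ^ 2 / a = a + 1 / a - 2 := by field_simp; ring
  linarith

lemma abs_inv_sub_eq_sqrt {a : ℝ} (ha : 0 < a) : |1 / a - a| = √((a + 1 / a) ^ 2 - 4) := by
  rw [← Real.sqrt_sq_eq_abs]; congr 1; field_simp; ring

/-- Tangent lines to the concave curve `s ↦ (s - 2 / s, √(s ^ 2 - 4))`. -/
lemma exists_tangent_slope {s₀ : ℝ} (hs₀ : 2 < s₀) : ∃ d > 1, ∀ s ≥ 2,
    √(s ^ 2 - 4) ≤ √(s₀ ^ 2 - 4) + d * ((s - 2 / s) - (s₀ - 2 / s₀)) := by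
  have hb : 0 < s₀ ^ 2 - 4 := by nlinarith
  set b := √(s₀ ^ 2 - 4) with hbdef
  have hb0 : 0 < b := Real.sqrt_pos.2 hb
  have hb2 : b ^ 2 = s₀ ^ 2 - 4 := Real.sq_sqrt hb.le
  -- The slope is `(s₀/b) / (1 + 2/s₀²)`, the quotient of the derivatives of the two coordinates at
  -- `s₀`.
  refine ⟨s₀ ^ 3 / (b * (s₀ ^ 2 + 2)), ?_, fun s hs => ?_⟩
  · rw [gt_iff_lt, lt_div_iff₀ (by positivity), one_mul]
    refine lt_of_pow_lt_pow_left₀ 2 (by positivity) ?_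
    rw [mul_pow, hb2]
    nlinarith [sq_nonneg s₀]
  · have hsb : 0 ≤ s ^ 2 - 4 := by nlinarith
    set β := √(s ^ 2 - 4) with hβdef
    have hβ0 : 0 ≤ β := Real.sqrt_nonneg _
    have hβ2 : β ^ 2 = s ^ 2 - 4 := Real.sq_sqrt hsb
    set c := s * s₀ - 4 with hc
    have hc0 : 0 < c := by nlinarith
    -- Multiplied by `b`, the claim bounds `β * b` by `c` minus a quadratic in `s - s₀`. This
    -- identity supplies it, since `c² - (βb)² = (c - βb)(c + βb)` and `c + βb ≤ 2c`.
    have hcb : c ^ 2 - (β * b) ^ 2 = 4 * (s - s₀) ^ 2 := by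
      rw [mul_pow, hb2, hβ2, hc]; ring
    have hle : β * b ≤ c := by
      refine (sq_le_sq₀ (by positivity) hc0.le).1 ?_
      nlinarith [sq_nonneg (s - s₀)]
    have h1 : 2 * (s - s₀) ^ 2 / c ≤ c - β * b := by
      rw [div_le_iff₀ hc0]; nlinarith [mul_nonneg hβ0 hb0.le]
    have h2 : 2 * s₀ * (s - s₀) ^ 2 / (s * (s₀ ^ 2 + 2)) ≤ 2 * (s - s₀) ^ 2 / c := by
      rw [div_le_div_iff₀ (by positivity) hc0]
      have : s₀ * c ≤ s * (s₀ ^ 2 + 2) := by rw [hc]; nlinarith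
      nlinarith [mul_le_mul_of_nonneg_left this (sq_nonneg (s - s₀))]
    have h3 : β * b ≤ c - 2 * s₀ * (s - s₀) ^ 2 / (s * (s₀ ^ 2 + 2)) := by linarith
    have e : c - 2 * s₀ * (s - s₀) ^ 2 / (s * (s₀ ^ 2 + 2))
        = b * (b + s₀ ^ 3 / (b * (s₀ ^ 2 + 2)) * ((s - 2 / s) - (s₀ - 2 / s₀))) := by
      have e1 : b * (b + s₀ ^ 3 / (b * (s₀ ^ 2 + 2)) * ((s - 2 / s) - (s₀ - 2 / s₀)))
        = b ^ 2 + s₀ ^ 3 / (s₀ ^ 2 + 2) * ((s - 2 / s) - (s₀ - 2 / s₀)) := by field_simp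
      rw [e1, hb2, hc]; field_simp; ring
    rw [e, mul_comm β b] at h3
    exact le_of_mul_le_mul_left h3 hb0

/-- The larger root `s` of `s - 2 / s = ρ`. -/
noncomputable def scale (ρ : ℝ) : ℝ := (ρ + √(ρ ^ 2 + 8)) / 2

lemma scale_pos (ρ : ℝ) : 0 < scale ρ := by
  have : |ρ| < √(ρ ^ 2 + 8) := by
    rw [← Real.sqrt_sq_eq_abs]; exact Real.sqrt_lt_sqrt (sq_nonneg _) (by linarith)
  rw [scale]; linarith [neg_abs_le ρ]

lemma scale_sq (ρ : ℝ) : scale ρ ^ 2 = ρ * scale ρ + 2 := by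
  have := Real.sq_sqrt (show 0 ≤ ρ ^ 2 + 8 by positivity)
  rw [scale]; linear_combination this / 4

lemma scale_sub (ρ : ℝ) : scale ρ - 2 / scale ρ = ρ := by
  have := scale_pos ρ
  have h := scale_sq ρ
  field_simp; linarith

lemma B_eq_sqrt_scale (ρ : ℝ) : B ρ = √(scale ρ ^ 2 - 4) := by
  rw [B, scale_sq, scale]; congr 1; ring

lemma two_le_scale {ρ : ℝ} (hρ : 1 ≤ ρ) : 2 ≤ scale ρ := by
  have : 3 ≤ √(ρ ^ 2 + 8) := by
    rw [Real.le_sqrt (by norm_num) (by positivity)]; nlinarith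
  rw [scale]; linarith

lemma two_lt_scale {ρ : ℝ} (hρ : 1 < ρ) : 2 < scale ρ := by
  have : 3 ≤ √(ρ ^ 2 + 8) := by
    rw [Real.le_sqrt (by norm_num) (by positivity)]; nlinarith
  rw [scale]; linarith

lemma B_one : B 1 = 0 := by
  have : √((1 : ℝ) ^ 2 + 8) = 3 := by
    rw [show (1 : ℝ) ^ 2 + 8 = 3 ^ 2 by norm_num]; exact Real.sqrt_sq (by norm_num)
  rw [B, this]; norm_num

lemma B_nonneg (ρ : ℝ) : 0 ≤ B ρ := Real.sqrt_nonneg _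

lemma continuous_B : Continuous B := by unfold B; fun_prop

/-! ### The Zolotarev distance of a standardized law to the symmetric two-point law -/

/-- Centered probability measures with unit variance and a finite third absolute moment. -/
structure IsStandard (μ : Measure ℝ) : Prop where
  prob : IsProbabilityMeasure μ
  integral_id : ∫ x, x ∂μ = 0
  integral_sq : ∫ x, x ^ 2 ∂μ = 1
  integrable_abs_cube : Integrable (fun x => |x| ^ 3) μ

/-- The third absolute moment. -/
noncomputable def absMoment3 (μ : Measure ℝ) : ℝ := ∫ x, |x| ^ 3 ∂μ

lemma integrable_id_of_abs_cube {μ : Measure ℝ} [IsProbabilityMeasure μ]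
    (h : Integrable (fun x => |x| ^ 3) μ) : Integrable (fun x => x) μ := by
  refine (h.add (integrable_const 1)).mono' (by fun_prop) (ae_of_all _ fun x => ?_)
  have := abs_nonneg x
  simp only [Real.norm_eq_abs, Pi.add_apply]
  nlinarith [sq_nonneg (|x| - 1), mul_nonneg this (sq_nonneg (|x| - 1))]

lemma integrable_sq_of_abs_cube {μ : Measure ℝ} [IsProbabilityMeasure μ]
    (h : Integrable (fun x => |x| ^ 3) μ) : Integrable (fun x => x ^ 2) μ := by
  refine (h.add (integrable_const 1)).mono' (by fun_prop) (ae_of_all _ fun x => ?_)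
  have := abs_nonneg x
  simp only [Real.norm_eq_abs, Pi.add_apply, abs_pow]
  nlinarith [sq_nonneg (|x| - 1), mul_nonneg this (sq_nonneg (|x| - 1))]

lemma IsStandard.integrable_id {μ : Measure ℝ} (h : IsStandard μ) :
    Integrable (fun x => x) μ :=
  have := h.prob
  integrable_id_of_abs_cube h.integrable_abs_cube

lemma IsStandard.integrable_sq {μ : Measure ℝ} (h : IsStandard μ) :
    Integrable (fun x => x ^ 2) μ :=
  have := h.prob
  integrable_sq_of_abs_cube h.integrable_abs_cube

lemma IsStandard.one_le_absMoment3 {μ : Measure ℝ} (h : IsStandard μ) : 1 ≤ absMoment3 μ := by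
  have := h.prob
  -- Pointwise this is `(|x| - 1)² (2|x| + 1) ≥ 0`.
  have h1 : ∫ x, (3 / 2 * x ^ 2 - 1 / 2) ∂μ ≤ ∫ x, |x| ^ 3 ∂μ := by
    refine integral_mono ((h.integrable_sq.const_mul _).sub (integrable_const _))
      h.integrable_abs_cube fun x => ?_
    have := abs_nonneg x
    simp only [← sq_abs x]
    nlinarith [sq_nonneg (|x| - 1), mul_nonneg this (sq_nonneg (|x| - 1))]
  rw [integral_sub (h.integrable_sq.const_mul _) (integrable_const _), integral_const_mul,
    h.integral_sq] at h1
  simp at h1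
  rw [absMoment3]; linarith

/-- Combines the penalized bound with the tangent line at `s₀`. Taking `s₀ = scale ρ` makes the
tangent touch at the moment of `μ`, so the term with `d` disappears. -/
lemma IsStandard.integral_sub_symm_le {μ : Measure ℝ} (h : IsStandard μ) {f : ℝ → ℝ}
    (hf : f ∈ F3b) : ∫ x, f x ∂μ - (f 1 + f (-1)) / 2 ≤ B (absMoment3 μ) / 6 := by
  have := h.prob
  have key : ∀ s₀ : ℝ, 2 < s₀ → ∃ d > 1, ∫ x, f x ∂μ - (f 1 + f (-1)) / 2
      ≤ (√(s₀ ^ 2 - 4) + d * (absMoment3 μ - (s₀ - 2 / s₀))) / 6 := fun s₀ hs₀ => by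
    obtain ⟨d, hd, htan⟩ := exists_tangent_slope hs₀
    obtain ⟨a, ha, hle⟩ := integral_sub_symm_le_of_penalty h.integral_id h.integral_sq
      h.integrable_id h.integrable_sq h.integrable_abs_cube hf hd
    refine ⟨d, hd, hle.trans ?_⟩
    have := htan _ (two_le_add_inv ha)
    rw [abs_inv_sub_eq_sqrt ha, absMoment3]
    linarith
  rcases h.one_le_absMoment3.lt_or_eq with hρ | hρ
  · obtain ⟨d, -, hle⟩ := key _ (two_lt_scale hρ)
    rw [scale_sub, sub_self, mul_zero, add_zero, ← B_eq_sqrt_scale] at hle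
    exact hle
  · rw [← hρ, B_one, zero_div]
    -- At moment `1` the tangent is vertical (`s₀ = 2`), so `s₀ = √(4 + ε²)` is used instead. There
    -- the height is `ε`, and the term with `d` is nonpositive because `s₀ - 2/s₀ ≥ 1`.
    refine le_of_forall_pos_le_add fun ε hε => ?_
    have hs : 2 < √(4 + ε ^ 2) := by
      rw [Real.lt_sqrt (by norm_num)]; nlinarith
    obtain ⟨d, hd, hle⟩ := key _ hs
    rw [Real.sq_sqrt (by positivity), add_sub_cancel_left, Real.sqrt_sq hε.le, ← hρ] at hle
    have h2 : 2 / √(4 + ε ^ 2) ≤ 1 := by rw [div_le_one (by linarith)]; linarith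
    nlinarith

/-- The symmetric law on `{-1, 1}`. -/
noncomputable def rademacher : Measure ℝ :=
  (2⁻¹ : ℝ≥0∞) • Measure.dirac (-1) + (2⁻¹ : ℝ≥0∞) • Measure.dirac 1

lemma integral_two_dirac {p q : ℝ≥0∞} (hp : p ≠ ∞) (hq : q ≠ ∞) (x y : ℝ) (f : ℝ → ℝ) :
    ∫ t, f t ∂(p • Measure.dirac x + q • Measure.dirac y) = p.toReal * f x + q.toReal * f y := by
  have h : ∀ z : ℝ, Integrable f (Measure.dirac z) := fun z =>
    integrable_dirac (by simp)
  rw [integral_add_measure ((h x).smul_measure hp) ((h y).smul_measure hq), integral_smul_measure,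
    integral_smul_measure, integral_dirac, integral_dirac]
  simp

lemma integrable_two_dirac {p q : ℝ≥0∞} (hp : p ≠ ∞) (hq : q ≠ ∞) (x y : ℝ) (f : ℝ → ℝ) :
    Integrable f (p • Measure.dirac x + q • Measure.dirac y) := by
  have h : ∀ z : ℝ, Integrable f (Measure.dirac z) := fun z => integrable_dirac (by simp)
  exact ((h x).smul_measure hp).add_measure ((h y).smul_measure hq)

lemma integral_rademacher (f : ℝ → ℝ) : ∫ x, f x ∂rademacher = (f 1 + f (-1)) / 2 := by
  rw [rademacher, integral_two_dirac (by simp) (by simp)]; simp; ring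

instance : IsProbabilityMeasure rademacher :=
  ⟨by simp [rademacher, ENNReal.inv_two_add_inv_two]⟩

lemma isStandard_rademacher : IsStandard rademacher :=
  ⟨inferInstance, by rw [integral_rademacher]; norm_num, by rw [integral_rademacher]; norm_num,
    integrable_two_dirac (by simp) (by simp) _ _ _⟩

lemma IsStandard.abs_integral_sub_rademacher_le {μ : Measure ℝ} (h : IsStandard μ) {f : ℝ → ℝ}
    (hf : f ∈ F3b) : |∫ x, f x ∂μ - ∫ x, f x ∂rademacher| ≤ B (absMoment3 μ) / 6 := by
  rw [integral_rademacher, abs_le]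
  have h1 := h.integral_sub_symm_le hf
  have h2 := h.integral_sub_symm_le (F3b.neg hf)
  rw [integral_neg] at h2
  constructor <;> linarith

/-! ### Gaussian smoothing -/

instance : IsProbabilityMeasure stdNormal := by unfold stdNormal; infer_instance

/-- Cameron–Martin formula: the exponential is the density of the shifted normal law. -/
lemma integral_stdNormal_comp_add (D : ℝ → ℝ) (hD : Measurable D) (δ : ℝ) :
    ∫ y, D (y + δ) ∂stdNormal
      = ∫ y, Real.exp (δ * y - δ ^ 2 / 2) * D y ∂stdNormal := by
  have h1 : stdNormal.map (fun y => y + δ) = gaussianReal δ 1 := by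
    rw [stdNormal, gaussianReal_map_add_const, zero_add]
  rw [← integral_map (φ := fun y => y + δ) (f := D) (by fun_prop) hD.aestronglyMeasurable, h1,
    stdNormal, integral_gaussianReal_eq_integral_smul one_ne_zero,
    integral_gaussianReal_eq_integral_smul one_ne_zero]
  refine integral_congr_ae (ae_of_all _ fun y => ?_)
  simp only [gaussianPDFReal, smul_eq_mul]
  have e : Real.exp (-(y - δ) ^ 2 / (2 * ((1 : ℝ≥0) : ℝ)))
      = Real.exp (-(y - 0) ^ 2 / (2 * ((1 : ℝ≥0) : ℝ))) * Real.exp (δ * y - δ ^ 2 / 2) := by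
    rw [← Real.exp_add]; congr 1; simp; ring
  rw [e]; ring

lemma integrable_exp_mul_stdNormal (t : ℝ) : Integrable (fun y => Real.exp (t * y)) stdNormal :=
  integrable_exp_mul_gaussianReal t

lemma integral_exp_mul_stdNormal (t : ℝ) :
    ∫ y, Real.exp (t * y) ∂stdNormal = Real.exp (t ^ 2 / 2) := by
  have := congrFun (mgf_id_gaussianReal (μ := 0) (v := 1)) t
  simpa [mgf, stdNormal] using this

/-- Shifting the standard normal law by `δ` changes integrals of functions bounded by `M`
by at most `2 M δ`. -/
lemma abs_integral_stdNormal_shift_le {D : ℝ → ℝ} (hD : Measurable D) {M δ : ℝ}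
    (hM : ∀ y, |D y| ≤ M) (hδ : 0 ≤ δ) :
    |∫ y, (D (y + δ) - D y) ∂stdNormal| ≤ 2 * M * δ := by
  have hM0 : 0 ≤ M := (abs_nonneg _).trans (hM 0)
  rcases hδ.eq_or_lt with rfl | hδ
  · simp
  rcases le_total 1 δ with h1 | h1
  · have : ‖∫ y, (D (y + δ) - D y) ∂stdNormal‖ ≤ 2 * M * stdNormal.real Set.univ := by
      refine norm_integral_le_of_norm_le_const (ae_of_all _ fun y => ?_)
      have h2 := hM (y + δ)
      have h3 := hM y
      rw [Real.norm_eq_abs]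
      rw [abs_le] at *
      constructor <;> linarith
    rw [Real.norm_eq_abs, probReal_univ, mul_one] at this
    nlinarith
  have hiD : ∀ E : ℝ → ℝ, Measurable E → (∀ y, |E y| ≤ M) → Integrable E stdNormal :=
    fun E hE hEM => Integrable.of_bound hE.aestronglyMeasurable M (ae_of_all _ fun y => by
      simpa using hEM y)
  set X : ℝ → ℝ := fun y => Real.exp (δ * y - δ ^ 2 / 2) with hX
  have hXe : X = fun y => Real.exp (-δ ^ 2 / 2) * Real.exp (δ * y) := by
    funext y; rw [hX, ← Real.exp_add]; ring_nf
  have hX2e : (fun y => X y ^ 2) = fun y => Real.exp (-δ ^ 2) * Real.exp (2 * δ * y) := by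
    funext y; rw [hX, ← Real.exp_add, ← Real.exp_nat_mul]; push_cast; ring_nf
  have hXi : Integrable X stdNormal := by
    rw [hXe]; exact (integrable_exp_mul_stdNormal δ).const_mul _
  have hX2i : Integrable (fun y => X y ^ 2) stdNormal := by
    rw [hX2e]; exact (integrable_exp_mul_stdNormal (2 * δ)).const_mul _
  have hX1 : ∫ y, X y ∂stdNormal = 1 := by
    rw [hXe, integral_const_mul, integral_exp_mul_stdNormal, ← Real.exp_add]
    rw [show -δ ^ 2 / 2 + δ ^ 2 / 2 = 0 by ring, Real.exp_zero]
  have hX2 : ∫ y, X y ^ 2 ∂stdNormal = Real.exp (δ ^ 2) := by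
    rw [hX2e, integral_const_mul, integral_exp_mul_stdNormal, ← Real.exp_add]
    congr 1; ring
  have hXD : Integrable (fun y => X y * D y) stdNormal :=
    hXi.mul_bdd (c := M) hD.aestronglyMeasurable (ae_of_all _ fun y => by simpa using hM y)
  have hshift : ∫ y, (D (y + δ) - D y) ∂stdNormal = ∫ y, (X y * D y - D y) ∂stdNormal := by
    rw [integral_sub (hiD (fun y => D (y + δ)) (by fun_prop) fun y => hM _) (hiD D hD hM),
      integral_sub hXD (hiD D hD hM), integral_stdNormal_comp_add D hD]
  -- Arithmetic-geometric mean bound of `|X - 1|` by its square. Integration leaves `∫ (X - 1)² =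
  -- exp(δ²) - 1`, which is at most `2δ²` for `δ ≤ 1`.
  set R : ℝ → ℝ := fun y => M * ((δ + (X y ^ 2 - 2 * X y + 1) / δ) / 2) with hR
  have hRi' : Integrable (fun y => X y ^ 2 - 2 * X y + 1) stdNormal :=
    (hX2i.sub (hXi.const_mul 2)).add (integrable_const 1)
  have hRi : Integrable R stdNormal :=
    ((((integrable_const δ).add (hRi'.div_const δ))).div_const 2).const_mul M
  have hRint : ∫ y, R y ∂stdNormal = M * ((δ + (Real.exp (δ ^ 2) - 1) / δ) / 2) := by
    have e1 : ∫ y, (X y ^ 2 - 2 * X y + 1) ∂stdNormal = Real.exp (δ ^ 2) - 1 := by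
      have hsub : Integrable (fun y => X y ^ 2 - 2 * X y) stdNormal := hX2i.sub (hXi.const_mul 2)
      rw [integral_add hsub (integrable_const 1), integral_sub hX2i (hXi.const_mul 2),
        integral_const_mul, hX1, hX2]
      simp; ring
    rw [hR, integral_const_mul, integral_div, integral_add (integrable_const δ)
      (hRi'.div_const δ), integral_div, e1]
    simp
  have hle : ‖∫ y, (X y * D y - D y) ∂stdNormal‖ ≤ ∫ y, R y ∂stdNormal := by
    refine norm_integral_le_of_norm_le hRi (ae_of_all _ fun y => ?_)
    have e1 : X y * D y - D y = (X y - 1) * D y := by ring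
    have e2 : |X y - 1| ≤ (δ + (X y ^ 2 - 2 * X y + 1) / δ) / 2 := by
      have e3 : X y ^ 2 - 2 * X y + 1 = |X y - 1| ^ 2 := by rw [sq_abs]; ring
      have e4 : 0 ≤ (|X y - 1| - δ) ^ 2 / δ := by positivity
      have e5 : (|X y - 1| - δ) ^ 2 / δ = |X y - 1| ^ 2 / δ - 2 * |X y - 1| + δ := by
        field_simp; ring
      rw [e3]; linarith
    rw [e1, Real.norm_eq_abs, abs_mul, hR, mul_comm]
    exact mul_le_mul (hM y) e2 (abs_nonneg _) hM0
  rw [hshift]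
  rw [Real.norm_eq_abs, hRint] at hle
  refine hle.trans ?_
  have hexp : Real.exp (δ ^ 2) - 1 ≤ 2 * δ ^ 2 := by
    have h := Real.abs_exp_sub_one_le (x := δ ^ 2) (by
      rw [abs_of_nonneg (by positivity)]; nlinarith)
    rw [abs_of_nonneg (by positivity : 0 ≤ δ ^ 2)] at h
    exact (le_abs_self _).trans h
  have h2 : (Real.exp (δ ^ 2) - 1) / δ ≤ 2 * δ := by
    rw [div_le_iff₀ hδ]; nlinarith
  have h3 : (δ + (Real.exp (δ ^ 2) - 1) / δ) / 2 ≤ 2 * δ := by linarith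
  calc _ ≤ M * (2 * δ) := by gcongr
    _ = _ := by ring

lemma continuous_iteratedDeriv_of_mem_F3 {f : ℝ → ℝ} (hf : f ∈ F3) :
    Continuous (iteratedDeriv 2 f) := hf.2.continuous

/-- Second differences of a Lipschitz function are of second order after Gaussian smoothing. -/
lemma abs_integral_second_difference_le {k : ℝ → ℝ} (hk : ∀ x y, |k x - k y| ≤ |x - y|)
    (hkc : Continuous k) {c s : ℝ} (hc : 0 < c) (hs : 0 ≤ s) :
    |∫ t, (k (c * t + s) + k (c * t - s) - 2 * k (c * t)) ∂stdNormal| ≤ 2 * s ^ 2 / c := by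
  -- The second difference of `k` is the increment, under a shift by `s/c`, of a first difference
  -- that is bounded by `s`.
  have h := abs_integral_stdNormal_shift_le (D := fun t => k (c * t) - k (c * t - s)) (M := s)
    (δ := s / c) (by fun_prop) (fun y => by
      refine (hk _ _).trans_eq ?_
      rw [sub_sub_cancel, abs_of_nonneg hs]) (by positivity)
  have e : ∀ t, k (c * (t + s / c)) - k (c * (t + s / c) - s) - (k (c * t) - k (c * t - s))
      = k (c * t + s) + k (c * t - s) - 2 * k (c * t) := fun t => by
    rw [show c * (t + s / c) = c * t + s by field_simp]
    rw [add_sub_cancel_right]; ring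
  simp only [e] at h
  calc _ ≤ _ := h
    _ = _ := by ring

/-- Taylor's formula for symmetric differences. -/
lemma symm_difference_eq_integral {f : ℝ → ℝ} (hf : f ∈ F3) (x h : ℝ) :
    f (x + h) + f (x - h) - 2 * f x - h ^ 2 * iteratedDeriv 2 f x
      = ∫ s in (0 : ℝ)..h, (h - s) * (iteratedDeriv 2 f (x + s) + iteratedDeriv 2 f (x - s)
          - 2 * iteratedDeriv 2 f x) := by
  set k := iteratedDeriv 2 f with hk
  have hkc : Continuous k := continuous_iteratedDeriv_of_mem_F3 hf
  -- Explicit antiderivative obtained from two integrations by parts; the first product vanishes at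
  -- both `s = h` and `s = 0`.
  have hd : ∀ s : ℝ, HasDerivAt (fun s => (h - s) * (deriv f (x + s) - deriv f (x - s)
      - 2 * s * k x) + (f (x + s) + f (x - s) - s ^ 2 * k x))
      ((h - s) * (k (x + s) + k (x - s) - 2 * k x)) s := fun s => by
    have a1 : HasDerivAt (fun s => x + s) 1 s := (hasDerivAt_id s).const_add x
    have a2 : HasDerivAt (fun s => x - s) (-1) s := (hasDerivAt_id s).const_sub x
    have a3 : HasDerivAt (fun s => h - s) (-1) s := (hasDerivAt_id s).const_sub h
    have b1 := (hasDerivAt_of_mem_F3 hf (x + s)).comp s a1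
    have b2 := (hasDerivAt_of_mem_F3 hf (x - s)).comp s a2
    have c1 := (hasDerivAt_deriv_of_mem_F3 hf (x + s)).comp s a1
    have c2 := (hasDerivAt_deriv_of_mem_F3 hf (x - s)).comp s a2
    have d1 : HasDerivAt (fun s => 2 * s * k x) (2 * k x) s := by
      simpa using ((hasDerivAt_id s).const_mul 2).mul_const (k x)
    have d2 : HasDerivAt (fun s => s ^ 2 * k x) (2 * s * k x) s := by
      simpa using (hasDerivAt_pow 2 s).mul_const (k x)
    convert! (a3.mul ((c1.sub c2).sub d1)).add ((b1.add b2).sub d2) using 1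
    simp only [Function.comp_apply, Pi.sub_apply, ← hk]
    ring
  rw [intervalIntegral.integral_eq_sub_of_hasDerivAt (fun s _ => hd s)
    (Continuous.intervalIntegrable (by fun_prop) _ _)]
  simp; ring

lemma integrable_of_lipschitz_stdNormal {k : ℝ → ℝ} (hk : ∀ x y, |k x - k y| ≤ |x - y|)
    (hkc : Continuous k) (c : ℝ) : Integrable (fun t => k (c * t)) stdNormal := by
  have hid : Integrable (fun x : ℝ => x) stdNormal :=
    memLp_one_iff_integrable.1 (memLp_id_gaussianReal 1)
  refine (((hid.const_mul c).abs).add (integrable_const |k 0|)).mono' (by fun_prop)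
    (ae_of_all _ fun t => ?_)
  have := hk (c * t) 0
  rw [sub_zero] at this
  simp only [Real.norm_eq_abs, Pi.add_apply]
  calc |k (c * t)| = |(k (c * t) - k 0) + k 0| := by ring_nf
    _ ≤ _ := (abs_add_le _ _).trans (by gcongr)

lemma F3b.integrable {f : ℝ → ℝ} (hf : f ∈ F3b) {μ : Measure ℝ} [IsFiniteMeasure μ] :
    Integrable f μ := by
  obtain ⟨hf3, K, hK⟩ := hf
  exact Integrable.of_bound (F3.continuous hf3).aestronglyMeasurable K
    (ae_of_all _ fun x => by simpa using hK x)

lemma F3b.integrable_comp {f : ℝ → ℝ} (hf : f ∈ F3b) {α : Type*} [MeasurableSpace α]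
    {μ : Measure α} [IsFiniteMeasure μ] {g : α → ℝ} (hg : Measurable g) :
    Integrable (fun x => f (g x)) μ := by
  obtain ⟨hf3, K, hK⟩ := hf
  exact Integrable.of_bound ((F3.continuous hf3).measurable.comp hg).aestronglyMeasurable K
    (ae_of_all _ fun x => by simpa using hK (g x))

/-- Gaussian smoothing of scale `c` gains a factor `1 / c` in the fourth-order error of symmetric
Taylor expansions of members of `F3`. -/
lemma abs_smoothed_symm_difference_le {f : ℝ → ℝ} (hf : f ∈ F3b) {c : ℝ} (hc : 0 < c) (h : ℝ) :
    |∫ t, f (c * t + h) ∂stdNormal + ∫ t, f (c * t + -h) ∂stdNormal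
        - 2 * ∫ t, f (c * t) ∂stdNormal - h ^ 2 * ∫ t, iteratedDeriv 2 f (c * t) ∂stdNormal|
      ≤ h ^ 4 / (6 * c) := by
  wlog hh : 0 ≤ h generalizing h
  · have := this (-h) (by linarith)
    rw [neg_neg, add_comm (∫ t, f (c * t + -h) ∂stdNormal), neg_sq,
      show (-h) ^ 4 = h ^ 4 by ring] at this
    exact this
  set k := iteratedDeriv 2 f with hk
  have hkc : Continuous k := continuous_iteratedDeriv_of_mem_F3 hf.1
  have hkl : ∀ x y, |k x - k y| ≤ |x - y| := abs_iteratedDeriv_sub_le_of_mem_F3 hf.1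
  have hki := integrable_of_lipschitz_stdNormal hkl hkc c
  have hi1 : Integrable (fun t => f (c * t + h)) stdNormal := F3b.integrable_comp hf (by fun_prop)
  have hi2 : Integrable (fun t => f (c * t + -h)) stdNormal := F3b.integrable_comp hf (by fun_prop)
  have hi3 : Integrable (fun t => f (c * t)) stdNormal := F3b.integrable_comp hf (by fun_prop)
  have e1 : ∫ t, f (c * t + h) ∂stdNormal + ∫ t, f (c * t + -h) ∂stdNormal
        - 2 * ∫ t, f (c * t) ∂stdNormal - h ^ 2 * ∫ t, k (c * t) ∂stdNormal
      = ∫ t, (f (c * t + h) + f (c * t - h) - 2 * f (c * t) - h ^ 2 * k (c * t)) ∂stdNormal := by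
    have j1 : Integrable (fun t => f (c * t + h) + f (c * t - h)) stdNormal := hi1.add hi2
    have j2 : Integrable (fun t => f (c * t + h) + f (c * t - h) - 2 * f (c * t)) stdNormal :=
      j1.sub (hi3.const_mul 2)
    rw [integral_sub j2 (hki.const_mul _), integral_sub j1 (hi3.const_mul 2), integral_const_mul,
      integral_const_mul]
    congr 2
    exact (integral_add hi1 hi2).symm
  rw [e1]
  have htay := fun x => symm_difference_eq_integral hf.1 x h
  simp only [← hk] at htay
  simp only [htay]
  have hprod : Integrable (Function.uncurry fun s t => (h - s) * (k (c * t + s) + k (c * t - s)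
      - 2 * k (c * t))) ((volume.restrict (Set.uIoc 0 h)).prod stdNormal) := by
    have hfin : IsFiniteMeasure (volume.restrict (Set.uIoc 0 h)) := by
      rw [Set.uIoc_of_le hh]; infer_instance
    refine Integrable.of_bound (C := h * (2 * h)) (Continuous.aestronglyMeasurable (by
      simp only [Function.uncurry_def]; fun_prop)) ?_
    have hs : ∀ᵐ p : ℝ × ℝ ∂((volume.restrict (Set.uIoc 0 h)).prod stdNormal),
        p.1 ∈ Set.uIoc 0 h :=
      Measure.quasiMeasurePreserving_fst.ae (ae_restrict_mem measurableSet_uIoc)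
    filter_upwards [hs] with p hp
    rw [Set.uIoc_of_le hh] at hp
    simp only [Function.uncurry, Real.norm_eq_abs, abs_mul]
    have b1 := hkl (c * p.2 + p.1) (c * p.2)
    have b2 := hkl (c * p.2 - p.1) (c * p.2)
    rw [add_sub_cancel_left, abs_of_pos hp.1] at b1
    rw [sub_sub_cancel_left, abs_neg, abs_of_pos hp.1] at b2
    refine mul_le_mul ?_ ?_ (abs_nonneg _) hh
    · rw [abs_of_nonneg (by linarith [hp.2])]; linarith [hp.1]
    · rw [abs_le] at *
      constructor <;> linarith [hp.2]
  -- For fixed `t` the second difference is only of order `s`. Integrating over `t` first yields the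
  -- order `s²/c`.
  rw [← intervalIntegral_integral_swap hprod]
  have hb := intervalIntegral.norm_integral_le_of_norm_le (μ := volume) hh
    (f := fun s => ∫ t, (h - s) * (k (c * t + s) + k (c * t - s) - 2 * k (c * t)) ∂stdNormal)
    (g := fun s => (h - s) * (2 * s ^ 2 / c)) (ae_of_all _ fun s hs => by
      rw [integral_const_mul, norm_mul, Real.norm_eq_abs, Real.norm_eq_abs,
        abs_of_nonneg (by linarith [hs.2])]
      gcongr
      · linarith [hs.2]
      · exact abs_integral_second_difference_le hkl hkc hc hs.1.le)
    (Continuous.intervalIntegrable (by fun_prop) _ _)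
  have hval : ∫ s in (0 : ℝ)..h, (h - s) * (2 * s ^ 2 / c) = h ^ 4 / (6 * c) := by
    have hd : ∀ s : ℝ, HasDerivAt (fun s => (2 * h / 3 * s ^ 3 - s ^ 4 / 2) / c)
        ((h - s) * (2 * s ^ 2 / c)) s := fun s => by
      convert! (((hasDerivAt_pow 3 s).const_mul (2 * h / 3)).sub
        ((hasDerivAt_pow 4 s).div_const 2)).div_const c using 1
      norm_num; ring
    rw [intervalIntegral.integral_eq_sub_of_hasDerivAt (fun s _ => hd s)
      (Continuous.intervalIntegrable (by fun_prop) _ _)]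
    field_simp; ring
  rw [hval] at hb
  exact hb

lemma integrable_pow_stdNormal (n : ℕ) : Integrable (fun x : ℝ => x ^ n) stdNormal := by
  have h := (memLp_id_gaussianReal' (μ := 0) (v := 1) n (by simp)).integrable_norm_pow'
  exact h.mono (by fun_prop) (ae_of_all _ fun x => by simp)

lemma integral_stdNormal_comp_neg (f : ℝ → ℝ) (hf : Measurable f) :
    ∫ x, f (-x) ∂stdNormal = ∫ x, f x ∂stdNormal := by
  have h : stdNormal.map (fun x => -x) = stdNormal := by
    rw [stdNormal, gaussianReal_map_neg, neg_zero]
  conv_rhs => rw [← h]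
  rw [integral_map (by fun_prop) hf.aestronglyMeasurable]

lemma integral_id_stdNormal : ∫ x, x ∂stdNormal = 0 := integral_id_gaussianReal

lemma integral_sq_stdNormal : ∫ x, x ^ 2 ∂stdNormal = 1 := by
  have h := variance_id_gaussianReal (μ := 0) (v := 1)
  rw [variance_eq_integral (by fun_prop)] at h
  simpa [stdNormal] using h

lemma isStandard_stdNormal : IsStandard stdNormal :=
  ⟨inferInstance, integral_id_stdNormal, integral_sq_stdNormal, by
    simpa using (integrable_pow_stdNormal 3).abs⟩

/-- Constant in the bound for replacing a symmetric sign by a normal variable under smoothing. -/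
noncomputable def smoothingConst : ℝ := (1 + ∫ x, x ^ 4 ∂stdNormal) / 12

lemma smoothingConst_nonneg : 0 ≤ smoothingConst := by
  have : 0 ≤ ∫ x, x ^ 4 ∂stdNormal := integral_nonneg fun x => by positivity
  rw [smoothingConst]; positivity

/-- Both laws are symmetric with unit variance, so the terms in `v 0` and `κ` cancel. What remains
is the fourth-order error, weighted by the fourth moments of the two laws. -/
lemma abs_smoothed_rademacher_sub_normal_le {f : ℝ → ℝ} (hf : f ∈ F3b) {c : ℝ} (hc : 0 < c) :
    |∫ y, ∫ t, f (c * t + y) ∂stdNormal ∂rademacher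
        - ∫ y, ∫ t, f (c * t + y) ∂stdNormal ∂stdNormal| ≤ smoothingConst / c := by
  set v : ℝ → ℝ := fun y => ∫ t, f (c * t + y) ∂stdNormal with hv
  set κ := ∫ t, iteratedDeriv 2 f (c * t) ∂stdNormal with hκ
  have hvi : Integrable v stdNormal :=
    (F3b.integrable_comp hf (μ := stdNormal.prod stdNormal) (g := fun p : ℝ × ℝ => c * p.2 + p.1)
      (by fun_prop)).integral_prod_left
  have hvin : Integrable (fun y => v (-y)) stdNormal :=
    (F3b.integrable_comp hf (μ := stdNormal.prod stdNormal) (g := fun p : ℝ × ℝ => c * p.2 + -p.1)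
      (by fun_prop)).integral_prod_left
  have hvm : Measurable v := by
    have : StronglyMeasurable (fun p : ℝ × ℝ => f (c * p.2 + p.1)) := by
      have := F3.continuous hf.1
      exact Continuous.stronglyMeasurable (by fun_prop)
    exact this.integral_prod_right'.measurable
  have hkey : ∀ h : ℝ, |v h + v (-h) - 2 * v 0 - h ^ 2 * κ| ≤ h ^ 4 / (6 * c) := fun h => by
    simpa [hv] using abs_smoothed_symm_difference_le hf hc h
  have hN : 2 * ∫ y, v y ∂stdNormal - 2 * v 0 - κ
      = ∫ y, (v y + v (-y) - 2 * v 0 - y ^ 2 * κ) ∂stdNormal := by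
    have j1 : Integrable (fun y => v y + v (-y)) stdNormal := hvi.add hvin
    have j2 : Integrable (fun y => v y + v (-y) - 2 * v 0) stdNormal :=
      j1.sub (integrable_const _)
    rw [integral_sub j2 ((integrable_pow_stdNormal 2).mul_const κ),
      integral_sub j1 (integrable_const _), integral_add hvi hvin,
      integral_stdNormal_comp_neg v hvm, integral_mul_const κ (fun y : ℝ => y ^ 2),
      integral_sq_stdNormal, integral_const]
    simp; ring
  have hNle : |2 * ∫ y, v y ∂stdNormal - 2 * v 0 - κ| ≤ (∫ x, x ^ 4 ∂stdNormal) / (6 * c) := by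
    rw [hN, ← integral_div, ← Real.norm_eq_abs]
    refine norm_integral_le_of_norm_le ((integrable_pow_stdNormal 4).div_const _)
      (ae_of_all _ fun y => ?_)
    exact hkey y
  have h1 := hkey 1
  rw [integral_rademacher]
  have e : smoothingConst / c = (1 ^ 4 / (6 * c) + (∫ x, x ^ 4 ∂stdNormal) / (6 * c)) / 2 := by
    rw [smoothingConst]; field_simp; ring
  rw [e]
  rw [one_pow, one_mul] at h1
  rw [abs_le] at *
  constructor <;> linarith [h1.1, h1.2, hNle.1, hNle.2]

/-! ### Comparison of convolutions -/

instance isProbabilityMeasure_convPow (μ : Measure ℝ) [IsProbabilityMeasure μ] (n : ℕ) :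
    IsProbabilityMeasure (convPow μ n) := by
  induction n with
  | zero => rw [convPow]; infer_instance
  | succ n ih => rw [convPow]; infer_instance

/-- `ScaledClose a c μ ν` says that the integrals of `x ↦ f (w + a x)` with respect to `μ` and `ν`
differ by at most `c`, for all bounded members `f` of `F3` and all `w`. -/
def ScaledClose (a c : ℝ) (μ ν : Measure ℝ) : Prop :=
  ∀ f ∈ F3b, ∀ w : ℝ, |∫ x, f (w + a * x) ∂μ - ∫ x, f (w + a * x) ∂ν| ≤ c

lemma ScaledClose.refl (a : ℝ) (μ : Measure ℝ) : ScaledClose a 0 μ μ := fun f _ w => by simp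

lemma ScaledClose.trans {a c₁ c₂ : ℝ} {μ ν κ : Measure ℝ} (h₁ : ScaledClose a c₁ μ ν)
    (h₂ : ScaledClose a c₂ ν κ) : ScaledClose a (c₁ + c₂) μ κ := fun f hf w =>
  (abs_sub_le _ (∫ x, f (w + a * x) ∂ν) _).trans (add_le_add (h₁ f hf w) (h₂ f hf w))

lemma ScaledClose.mono {a c₁ c₂ : ℝ} {μ ν : Measure ℝ} (h : ScaledClose a c₁ μ ν)
    (hc : c₁ ≤ c₂) : ScaledClose a c₂ μ ν := fun f hf w => (h f hf w).trans hc

lemma ScaledClose.symm {a c : ℝ} {μ ν : Measure ℝ} (h : ScaledClose a c μ ν) :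
    ScaledClose a c ν μ := fun f hf w => by rw [abs_sub_comm]; exact h f hf w

lemma F3b.integral_conv {f : ℝ → ℝ} (hf : f ∈ F3b) (w a : ℝ) (μ ν : Measure ℝ)
    [IsProbabilityMeasure μ] [IsProbabilityMeasure ν] :
    ∫ x, f (w + a * x) ∂(μ.conv ν) = ∫ x, ∫ y, f ((w + a * x) + a * y) ∂ν ∂μ := by
  rw [MeasureTheory.integral_conv (F3b.integrable_comp hf (by fun_prop))]
  simp only [mul_add, add_assoc]

/-- Uniformity in the shift `w` is what makes closeness stable under convolution: the added variable
merely shifts the test function. -/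
lemma ScaledClose.conv_left {a c : ℝ} {ν₁ ν₂ : Measure ℝ} [IsProbabilityMeasure ν₁]
    [IsProbabilityMeasure ν₂] (h : ScaledClose a c ν₁ ν₂) (μ : Measure ℝ)
    [IsProbabilityMeasure μ] : ScaledClose a c (μ.conv ν₁) (μ.conv ν₂) := fun f hf w => by
  rw [F3b.integral_conv hf, F3b.integral_conv hf]
  have hi : ∀ ν : Measure ℝ, IsProbabilityMeasure ν →
      Integrable (fun x => ∫ y, f ((w + a * x) + a * y) ∂ν) μ := fun ν _ =>
    (F3b.integrable_comp hf (μ := μ.prod ν) (g := fun p : ℝ × ℝ => (w + a * p.1) + a * p.2)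
      (by fun_prop)).integral_prod_left
  rw [← integral_sub (hi ν₁ inferInstance) (hi ν₂ inferInstance)]
  have := norm_integral_le_of_norm_le_const (μ := μ)
    (f := fun x => ∫ y, f ((w + a * x) + a * y) ∂ν₁ - ∫ y, f ((w + a * x) + a * y) ∂ν₂)
    (ae_of_all _ fun x => h f hf (w + a * x))
  simpa using this

lemma ScaledClose.conv {a c₁ c₂ : ℝ} {μ₁ μ₂ ν₁ ν₂ : Measure ℝ} [IsProbabilityMeasure μ₁]
    [IsProbabilityMeasure μ₂] [IsProbabilityMeasure ν₁] [IsProbabilityMeasure ν₂]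
    (h₁ : ScaledClose a c₁ μ₁ ν₁) (h₂ : ScaledClose a c₂ μ₂ ν₂) :
    ScaledClose a (c₁ + c₂) (μ₁.conv μ₂) (ν₁.conv ν₂) := by
  have h := h₁.conv_left μ₂
  rw [Measure.conv_comm μ₂ μ₁, Measure.conv_comm μ₂ ν₁] at h
  exact h.trans (h₂.conv_left ν₁)

lemma IsStandard.scaledClose_rademacher {μ : Measure ℝ} (h : IsStandard μ) {a : ℝ} (ha : 0 < a) :
    ScaledClose a (a ^ 3 * (B (absMoment3 μ) / 6)) μ rademacher := fun f hf w => by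
  have := h.abs_integral_sub_rademacher_le (F3b.comp_affine hf w ha)
  rw [integral_div, integral_div, ← sub_div, abs_div, abs_of_pos (pow_pos ha 3),
    div_le_iff₀ (pow_pos ha 3)] at this
  linarith

lemma IsStandard.scaledClose_convPow {μ : Measure ℝ} (h : IsStandard μ) {a : ℝ} (ha : 0 < a)
    (n : ℕ) : ScaledClose a (n * (a ^ 3 * (B (absMoment3 μ) / 6))) (convPow μ n)
      (convPow rademacher n) := by
  have := h.prob
  induction n with
  | zero => simpa [convPow] using ScaledClose.refl a _
  | succ n ih =>
    rw [convPow, convPow]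
    convert! ih.conv (h.scaledClose_rademacher ha) using 1
    push_cast; ring

lemma stdNormal_map_mul {c : ℝ} (v : ℝ≥0) (hc : c ^ 2 = v) :
    stdNormal.map (fun x => c * x) = gaussianReal 0 v := by
  rw [stdNormal, gaussianReal_map_const_mul, mul_zero, mul_one]
  congr 1
  ext; simpa using hc

lemma scaledClose_gaussian_conv {a : ℝ} (ha : 0 < a) {v : ℝ≥0} (hv : 0 < v) :
    ScaledClose a (a ^ 3 * (smoothingConst / √v)) ((gaussianReal 0 v).conv rademacher)
      ((gaussianReal 0 v).conv stdNormal) := fun f hf w => by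
  have hF := F3b.comp_affine hf w ha
  set F : ℝ → ℝ := fun x => f (w + a * x) / a ^ 3 with hFdef
  have hFc : Continuous F := F3.continuous hF.1
  have hc : 0 < √(v : ℝ) := Real.sqrt_pos.2 (by exact_mod_cast hv)
  have hN : stdNormal.map (fun x => √(v : ℝ) * x) = gaussianReal 0 v :=
    stdNormal_map_mul v (Real.sq_sqrt v.2)
  have key : ∀ ν : Measure ℝ, IsProbabilityMeasure ν → ∫ x, f (w + a * x)
      ∂((gaussianReal 0 v).conv ν) = a ^ 3 * ∫ y, ∫ t, F (√(v : ℝ) * t + y) ∂stdNormal ∂ν := by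
    intro ν _
    have e1 : ∀ x, f (w + a * x) = a ^ 3 * F x := fun x => by rw [hFdef]; field_simp
    simp only [e1]
    rw [integral_const_mul, Measure.conv_comm, MeasureTheory.integral_conv (F3b.integrable hF)]
    congr 1
    refine integral_congr_ae (ae_of_all _ fun y => ?_)
    simp only
    rw [← hN, integral_map (by fun_prop) (Continuous.aestronglyMeasurable (by fun_prop))]
    simp only [add_comm]
  rw [key _ inferInstance, key _ inferInstance, ← mul_sub, abs_mul, abs_of_pos (pow_pos ha 3)]
  gcongr
  exact abs_smoothed_rademacher_sub_normal_le hF hc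

/-- The first sign is replaced without smoothing, at the cost of the `B` term. The next one, with
`j` normals in place, costs `smoothingConst / √j`, and these sum to at most `2 * smoothingConst *
√n`. At `a = 1/√(n + 1)` the total is of order `1/n`. -/
lemma scaledClose_convPow_rademacher_gaussian {a : ℝ} (ha : 0 < a) (n : ℕ) :
    ScaledClose a (a ^ 3 * (B (absMoment3 stdNormal) / 6 + 2 * smoothingConst * √(n : ℝ)))
      (convPow rademacher (n + 1)) (gaussianReal 0 ((n + 1 : ℕ) : ℝ≥0)) := by
  induction n with
  | zero =>
    have h := (isStandard_stdNormal.scaledClose_rademacher ha).symm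
    simpa [convPow, stdNormal] using h
  | succ n ih =>
    rw [convPow]
    have h1 := ih.conv (ScaledClose.refl a rademacher)
    have h2 := scaledClose_gaussian_conv ha (v := ((n + 1 : ℕ) : ℝ≥0)) (by positivity)
    rw [stdNormal, gaussianReal_conv_gaussianReal, add_zero] at h2
    have h3 := h1.trans h2
    refine (h3.mono ?_).trans (c₂ := 0) ?_ |>.mono (add_zero _).le
    · rw [add_zero, ← mul_add]
      refine mul_le_mul_of_nonneg_left ?_ (by positivity)
      have hs : 0 < √((n + 1 : ℕ) : ℝ) := Real.sqrt_pos.2 (by positivity)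
      have hs1 : √((n + 1 : ℕ) : ℝ) ^ 2 = n + 1 := by rw [Real.sq_sqrt (by positivity)]; simp
      have hs2 : √(n : ℝ) ^ 2 = n := Real.sq_sqrt (by positivity)
      -- Telescoping form of the estimate of `∑ 1/√j` by `2√n`.
      have hle : 1 / √((n + 1 : ℕ) : ℝ) ≤ 2 * (√((n + 1 : ℕ) : ℝ) - √(n : ℝ)) := by
        rw [div_le_iff₀ hs]
        nlinarith [sq_nonneg (√((n + 1 : ℕ) : ℝ) - √(n : ℝ))]
      have := mul_le_mul_of_nonneg_left hle smoothingConst_nonneg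
      rw [mul_one_div] at this
      push_cast at this ⊢
      linarith
    · convert! ScaledClose.refl a _ using 2
      push_cast; ring

/-! ### The distance `zeta3` -/

lemma zeta3_le_of_forall {P Q : Measure ℝ} {c : ℝ}
    (h : ∀ f ∈ F3b, |∫ x, f x ∂P - ∫ x, f x ∂Q| ≤ c) : zeta3 P Q ≤ ENNReal.ofReal c :=
  iSup₂_le fun f hf => ENNReal.ofReal_le_ofReal (h f hf)

lemma ofReal_le_zeta3 {P Q : Measure ℝ} {f : ℝ → ℝ} (hf : f ∈ F3b) :
    ENNReal.ofReal |∫ x, f x ∂P - ∫ x, f x ∂Q| ≤ zeta3 P Q := by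
  rw [zeta3]
  exact le_biSup (fun f : ℝ → ℝ => ENNReal.ofReal |∫ x, f x ∂P - ∫ x, f x ∂Q|) hf

lemma zeta3_comm (P Q : Measure ℝ) : zeta3 P Q = zeta3 Q P := by
  simp only [zeta3, abs_sub_comm]

lemma zeta3_triangle (P Q R : Measure ℝ) : zeta3 P R ≤ zeta3 P Q + zeta3 Q R :=
  iSup₂_le fun _ hf => (ENNReal.ofReal_le_ofReal (abs_sub_le _ _ _)).trans
    (ENNReal.ofReal_add_le.trans (add_le_add (ofReal_le_zeta3 hf) (ofReal_le_zeta3 hf)))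

lemma ScaledClose.zeta3_map_le {r c : ℝ} {μ ν : Measure ℝ} (h : ScaledClose (1 / r) c μ ν) :
    zeta3 (μ.map (fun x => x / r)) (ν.map (fun x => x / r)) ≤ ENNReal.ofReal c :=
  zeta3_le_of_forall fun f hf => by
    rw [integral_map (by fun_prop) (F3.continuous hf.1).aestronglyMeasurable,
      integral_map (by fun_prop) (F3.continuous hf.1).aestronglyMeasurable]
    have := h f hf 0
    simpa [div_eq_inv_mul] using this

/-! ### Moments of convolution powers and standardization -/

lemma abs_add_cube_le (x y : ℝ) : |x + y| ^ 3 ≤ 4 * (|x| ^ 3 + |y| ^ 3) := by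
  have hx := abs_nonneg x
  have hy := abs_nonneg y
  calc |x + y| ^ 3 ≤ (|x| + |y|) ^ 3 := by gcongr; exact abs_add_le x y
    _ ≤ _ := by nlinarith [mul_nonneg (add_nonneg hx hy) (sq_nonneg (|x| - |y|))]

lemma integrable_cube_of_abs_cube {μ : Measure ℝ} (h : Integrable (fun x => |x| ^ 3) μ) :
    Integrable (fun x => x ^ 3) μ :=
  h.mono' (by fun_prop) (ae_of_all _ fun x => by simp)

lemma integrable_abs_cube_conv {μ ν : Measure ℝ} [IsProbabilityMeasure μ] [IsProbabilityMeasure ν]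
    (hμ : Integrable (fun x => |x| ^ 3) μ) (hν : Integrable (fun x => |x| ^ 3) ν) :
    Integrable (fun x => |x| ^ 3) (μ.conv ν) := by
  rw [Measure.conv, integrable_map_measure (by fun_prop) (by fun_prop)]
  refine (((hμ.comp_fst ν).add (hν.comp_snd μ)).const_mul 4).mono' (by fun_prop)
    (ae_of_all _ fun p => ?_)
  simp only [Function.comp_apply, Real.norm_eq_abs, Pi.add_apply, abs_pow, abs_abs]
  exact abs_add_cube_le _ _

lemma integral_conv_id {μ ν : Measure ℝ} [IsProbabilityMeasure μ] [IsProbabilityMeasure ν]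
    (hμ : Integrable (fun x => |x| ^ 3) μ) (hν : Integrable (fun x => |x| ^ 3) ν) :
    ∫ x, x ∂(μ.conv ν) = ∫ x, x ∂μ + ∫ x, x ∂ν := by
  have i1 := integrable_id_of_abs_cube hμ
  have j1 := integrable_id_of_abs_cube hν
  rw [MeasureTheory.integral_conv (integrable_id_of_abs_cube (integrable_abs_cube_conv hμ hν))]
  have e : ∀ x, ∫ y, (x + y) ∂ν = x + ∫ y, y ∂ν := fun x => by
    rw [integral_add (integrable_const x) j1]; simp
  simp only [e]
  rw [integral_add i1 (integrable_const _)]; simp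

lemma integral_conv_sq {μ ν : Measure ℝ} [IsProbabilityMeasure μ] [IsProbabilityMeasure ν]
    (hμ : Integrable (fun x => |x| ^ 3) μ) (hν : Integrable (fun x => |x| ^ 3) ν)
    (h0 : ∫ x, x ∂ν = 0) :
    ∫ x, x ^ 2 ∂(μ.conv ν) = ∫ x, x ^ 2 ∂μ + ∫ x, x ^ 2 ∂ν := by
  have i2 := integrable_sq_of_abs_cube hμ
  have j1 := integrable_id_of_abs_cube hν
  have j2 := integrable_sq_of_abs_cube hν
  rw [MeasureTheory.integral_conv (integrable_sq_of_abs_cube (integrable_abs_cube_conv hμ hν))]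
  have e : ∀ x, ∫ y, (x + y) ^ 2 ∂ν = x ^ 2 + ∫ y, y ^ 2 ∂ν := fun x => by
    have e1 : ∀ y, (x + y) ^ 2 = (x ^ 2 + 2 * x * y) + y ^ 2 := fun y => by ring
    have k1 : Integrable (fun y => x ^ 2 + 2 * x * y) ν :=
      (integrable_const _).add (j1.const_mul _)
    simp only [e1]
    rw [integral_add k1 j2, integral_add (integrable_const _) (j1.const_mul _),
      integral_const_mul, h0]
    simp
  simp only [e]
  rw [integral_add i2 (integrable_const _)]; simp

lemma integral_conv_cube {μ ν : Measure ℝ} [IsProbabilityMeasure μ] [IsProbabilityMeasure ν]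
    (hμ : Integrable (fun x => |x| ^ 3) μ) (hν : Integrable (fun x => |x| ^ 3) ν)
    (h0 : ∫ x, x ∂μ = 0) (h0' : ∫ x, x ∂ν = 0) :
    ∫ x, x ^ 3 ∂(μ.conv ν) = ∫ x, x ^ 3 ∂μ + ∫ x, x ^ 3 ∂ν := by
  have i1 := integrable_id_of_abs_cube hμ
  have i3 := integrable_cube_of_abs_cube hμ
  have j1 := integrable_id_of_abs_cube hν
  have j2 := integrable_sq_of_abs_cube hν
  have j3 := integrable_cube_of_abs_cube hν
  rw [MeasureTheory.integral_conv (integrable_cube_of_abs_cube (integrable_abs_cube_conv hμ hν))]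
  have e : ∀ x, ∫ y, (x + y) ^ 3 ∂ν
      = (x ^ 3 + 3 * (∫ y, y ^ 2 ∂ν) * x) + ∫ y, y ^ 3 ∂ν := fun x => by
    have e1 : ∀ y, (x + y) ^ 3 = ((x ^ 3 + 3 * x ^ 2 * y) + 3 * x * y ^ 2) + y ^ 3 :=
      fun y => by ring
    have k1 : Integrable (fun y => x ^ 3 + 3 * x ^ 2 * y) ν :=
      (integrable_const _).add (j1.const_mul _)
    have k2 : Integrable (fun y => (x ^ 3 + 3 * x ^ 2 * y) + 3 * x * y ^ 2) ν :=
      k1.add (j2.const_mul _)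
    simp only [e1]
    rw [integral_add k2 j3, integral_add k1 (j2.const_mul _),
      integral_add (integrable_const _) (j1.const_mul _),
      integral_const_mul, integral_const_mul, h0']
    simp; ring
  simp only [e]
  have k1 : Integrable (fun x => x ^ 3 + 3 * (∫ y, y ^ 2 ∂ν) * x) μ := i3.add (i1.const_mul _)
  rw [integral_add k1 (integrable_const _), integral_add i3 (i1.const_mul _), integral_const_mul,
    h0]
  simp

lemma IsStandard.convPow_moments {μ : Measure ℝ} (h : IsStandard μ) (n : ℕ) :
    Integrable (fun x => |x| ^ 3) (convPow μ n) ∧ ∫ x, x ∂(convPow μ n) = 0 ∧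
      ∫ x, x ^ 2 ∂(convPow μ n) = n ∧ ∫ x, x ^ 3 ∂(convPow μ n) = n * ∫ x, x ^ 3 ∂μ := by
  have := h.prob
  induction n with
  | zero => simp [convPow, integrable_dirac]
  | succ n ih =>
    obtain ⟨i1, i2, i3, i4⟩ := ih
    rw [convPow]
    refine ⟨integrable_abs_cube_conv i1 h.integrable_abs_cube, ?_, ?_, ?_⟩
    · rw [integral_conv_id i1 h.integrable_abs_cube, i2, h.integral_id, add_zero]
    · rw [integral_conv_sq i1 h.integrable_abs_cube h.integral_id, i3, h.integral_sq]; simp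
    · rw [integral_conv_cube i1 h.integrable_abs_cube i2 h.integral_id, i4]; push_cast; ring

lemma conv_map_affine (μ ν : Measure ℝ) [IsProbabilityMeasure μ] [IsProbabilityMeasure ν]
    (α β γ : ℝ) : (μ.map (fun x => α * x + β)).conv (ν.map (fun x => α * x + γ))
      = (μ.conv ν).map (fun x => α * x + (β + γ)) := by
  rw [Measure.conv, Measure.map_prod_map _ _ (by fun_prop) (by fun_prop),
    Measure.map_map (by fun_prop) (by fun_prop), Measure.conv,
    Measure.map_map (by fun_prop) (by fun_prop)]
  congr 1
  funext p
  simp; ring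

lemma convPow_map_affine (μ : Measure ℝ) [IsProbabilityMeasure μ] (α β : ℝ) (n : ℕ) :
    convPow (μ.map (fun x => α * x + β)) n = (convPow μ n).map (fun x => α * x + n * β) := by
  have hp : IsProbabilityMeasure (μ.map (fun x => α * x + β)) :=
    Measure.isProbabilityMeasure_map (by fun_prop)
  induction n with
  | zero => simp [convPow, Measure.map_dirac' (show Measurable fun x : ℝ => α * x by fun_prop)]
  | succ n ih =>
    rw [convPow, ih, conv_map_affine, convPow]
    congr 1
    funext x; push_cast; ring

lemma sd_eq_sqrt (μ : Measure ℝ) : sd μ = √(∫ x, (x - mean μ) ^ 2 ∂μ) := by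
  rw [sd, variance_eq_integral (by fun_prop)]; rfl

lemma mean_map_affine {μ : Measure ℝ} [IsProbabilityMeasure μ]
    (hi : Integrable (fun x => |x| ^ 3) μ) (h1 : ∫ x, x ∂μ = 0) (α β : ℝ) :
    mean (μ.map (fun x => α * x + β)) = β := by
  rw [mean, integral_map (by fun_prop) (by fun_prop),
    integral_add ((integrable_id_of_abs_cube hi).const_mul α) (integrable_const β),
    integral_const_mul, h1]
  simp

lemma sd_map_affine {μ : Measure ℝ} [IsProbabilityMeasure μ]
    (hi : Integrable (fun x => |x| ^ 3) μ) (h1 : ∫ x, x ∂μ = 0) {v : ℝ}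
    (h2 : ∫ x, x ^ 2 ∂μ = v) {α : ℝ} (hα : 0 ≤ α) (β : ℝ) :
    sd (μ.map (fun x => α * x + β)) = α * √v := by
  rw [sd_eq_sqrt, mean_map_affine hi h1, integral_map (by fun_prop) (by fun_prop)]
  simp only [add_sub_cancel_right, mul_pow]
  rw [integral_const_mul, h2, Real.sqrt_mul (by positivity), Real.sqrt_sq hα]

lemma standardize_map_affine {μ : Measure ℝ} [IsProbabilityMeasure μ]
    (hi : Integrable (fun x => |x| ^ 3) μ) (h1 : ∫ x, x ∂μ = 0) {v : ℝ}
    (h2 : ∫ x, x ^ 2 ∂μ = v) {α : ℝ} (hα : 0 < α) (β : ℝ) :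
    standardize (μ.map (fun x => α * x + β)) = μ.map (fun x => x / √v) := by
  rw [standardize, mean_map_affine hi h1, sd_map_affine hi h1 h2 hα.le,
    Measure.map_map (by fun_prop) (by fun_prop)]
  congr 1
  funext x
  simp only [Function.comp_apply, add_sub_cancel_right]
  exact mul_div_mul_left _ _ hα.ne'

lemma IsStandard.standardize_convPow_map_affine {μ : Measure ℝ} (h : IsStandard μ) {α : ℝ}
    (hα : 0 < α) (β : ℝ) (n : ℕ) :
    standardize (convPow (μ.map (fun x => α * x + β)) n)
      = (convPow μ n).map (fun x => x / √(n : ℝ)) := by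
  have := h.prob
  obtain ⟨i1, i2, i3, -⟩ := h.convPow_moments n
  rw [convPow_map_affine, standardize_map_affine i1 i2 i3 hα]

lemma IsStandard.standardize_convPow {μ : Measure ℝ} (h : IsStandard μ) (n : ℕ) :
    standardize (convPow μ n) = (convPow μ n).map (fun x => x / √(n : ℝ)) := by
  have := h.standardize_convPow_map_affine one_pos 0 n
  simpa using this

lemma IsStandard.mean_eq {μ : Measure ℝ} (h : IsStandard μ) : mean μ = 0 := h.integral_id

lemma IsStandard.sd_eq {μ : Measure ℝ} (h : IsStandard μ) : sd μ = 1 := by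
  rw [sd_eq_sqrt, h.mean_eq]; simp [h.integral_sq]

lemma IsStandard.mem_P3 {μ : Measure ℝ} (h : IsStandard μ) : μ ∈ P3 :=
  ⟨h.prob, h.integrable_abs_cube, by rw [h.sd_eq]; exact one_pos⟩

lemma IsStandard.rho_eq {μ : Measure ℝ} (h : IsStandard μ) : rho μ = absMoment3 μ := by
  simp [rho, absMoment3, h.mean_eq, h.sd_eq]

lemma standardize_map_eq {P : Measure ℝ} (hP : P ∈ P3) :
    (standardize P).map (fun x => sd P * x + mean P) = P := by
  have hs := hP.2.2
  rw [standardize, Measure.map_map (by fun_prop) (by fun_prop)]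
  have : ((fun x => sd P * x + mean P) ∘ fun x => (x - mean P) / sd P) = id := by
    funext x; simp only [Function.comp_apply, id]; field_simp; ring
  rw [this, Measure.map_id]

lemma isStandard_standardize {P : Measure ℝ} (hP : P ∈ P3) : IsStandard (standardize P) := by
  obtain ⟨hp, hi, hs⟩ := hP
  have i1 := integrable_id_of_abs_cube hi
  have hv : sd P ^ 2 = ∫ x, (x - mean P) ^ 2 ∂P := by
    rw [sd_eq_sqrt, Real.sq_sqrt (integral_nonneg fun x => sq_nonneg _)]
  refine ⟨Measure.isProbabilityMeasure_map (by fun_prop), ?_, ?_, ?_⟩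
  · rw [standardize, integral_map (by fun_prop) (by fun_prop), integral_div,
      integral_sub i1 (integrable_const _)]
    simp [mean]
  · rw [standardize, integral_map (by fun_prop) (by fun_prop)]
    simp only [div_pow]
    rw [integral_div, ← hv, div_self (by positivity)]
  · rw [standardize, integrable_map_measure (by fun_prop) (by fun_prop)]
    refine (((hi.add (integrable_const (|mean P| ^ 3))).const_mul 4).div_const
      (sd P ^ 3)).mono' (by fun_prop) (ae_of_all _ fun x => ?_)
    simp only [Function.comp_apply, Real.norm_eq_abs, Pi.add_apply, abs_pow, abs_abs, abs_div,
      div_pow, abs_of_pos hs]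
    gcongr
    have := abs_add_cube_le x (-mean P)
    rwa [abs_neg, ← sub_eq_add_neg] at this

lemma absMoment3_standardize (P : Measure ℝ) : absMoment3 (standardize P) = rho P := by
  rw [absMoment3, standardize, integral_map (by fun_prop) (by fun_prop), rho]

/-- Affine invariance: `P` is an affine image of its own standardization, so only standard laws need
to be convolved. -/
lemma standardize_convPow_eq {P : Measure ℝ} (hP : P ∈ P3) (n : ℕ) :
    standardize (convPow P n) = (convPow (standardize P) n).map (fun x => x / √(n : ℝ)) := by
  conv_lhs => rw [← standardize_map_eq hP]
  exact (isStandard_standardize hP).standardize_convPow_map_affine hP.2.2 _ n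

lemma standardize_symBinomial (n : ℕ) :
    standardize (symBinomial n) = (convPow rademacher n).map (fun x => x / √(n : ℝ)) := by
  rw [← isStandard_rademacher.standardize_convPow_map_affine (α := 1 / 2) (by norm_num) (1 / 2) n,
    symBinomial]
  congr 2
  rw [rademacher, Measure.map_add _ _ (by fun_prop), Measure.map_smul, Measure.map_smul,
    Measure.map_dirac' (by fun_prop), Measure.map_dirac' (by fun_prop)]
  norm_num

/-! ### Upper bounds -/

lemma zeta3_standardize_convPow_symBinomial_le {P : Measure ℝ} (hP : P ∈ P3) {n : ℕ} (hn : 1 ≤ n) :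
    zeta3 (standardize (convPow P n)) (standardize (symBinomial n))
      ≤ ENNReal.ofReal (B (rho P) / (6 * √(n : ℝ))) := by
  have hs : 0 < √(n : ℝ) := Real.sqrt_pos.2 (by exact_mod_cast hn)
  have hs2 : √(n : ℝ) ^ 2 = n := Real.sq_sqrt (by positivity)
  rw [standardize_convPow_eq hP, standardize_symBinomial]
  have h := (isStandard_standardize hP).scaledClose_convPow (one_div_pos.2 hs) n
  refine h.zeta3_map_le.trans_eq ?_
  rw [absMoment3_standardize]
  congr 1
  generalize √(n : ℝ) = r at *
  rw [← hs2]; field_simp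

lemma gaussianReal_map_div_sqrt {n : ℕ} (hn : 1 ≤ n) :
    (gaussianReal 0 (n : ℝ≥0)).map (fun x => x / √(n : ℝ)) = stdNormal := by
  have hs : 0 < √(n : ℝ) := Real.sqrt_pos.2 (by exact_mod_cast hn)
  rw [← stdNormal_map_mul (c := √(n : ℝ)) n (by rw [Real.sq_sqrt (by positivity)]; simp),
    Measure.map_map (by fun_prop) (by fun_prop)]
  have : ((fun x => x / √(n : ℝ)) ∘ fun x => √(n : ℝ) * x) = id := by
    funext x; simp only [Function.comp_apply, id]; field_simp
  rw [this, Measure.map_id]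

/-- `ε_n` is of order `1 / n`. -/
lemma exists_epsilon_le : ∃ b ≥ 0, ∀ n : ℕ, 1 ≤ n →
    epsilon n ≤ ENNReal.ofReal (b / n) := by
  refine ⟨B (absMoment3 stdNormal) / 6 + 2 * smoothingConst, ?_, fun n hn => ?_⟩
  · have := B_nonneg (absMoment3 stdNormal)
    have := smoothingConst_nonneg
    positivity
  obtain ⟨m, rfl⟩ : ∃ m, n = m + 1 := ⟨n - 1, by omega⟩
  have hs : 0 < √((m + 1 : ℕ) : ℝ) := Real.sqrt_pos.2 (by positivity)
  have hs1 : 1 ≤ √((m + 1 : ℕ) : ℝ) := Real.one_le_sqrt.2 (by exact_mod_cast hn)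
  have hs2 : √((m + 1 : ℕ) : ℝ) ^ 2 = ((m + 1 : ℕ) : ℝ) := Real.sq_sqrt (by positivity)
  have h := (scaledClose_convPow_rademacher_gaussian (one_div_pos.2 hs) m).zeta3_map_le
  rw [gaussianReal_map_div_sqrt hn, ← standardize_symBinomial] at h
  refine h.trans (ENNReal.ofReal_le_ofReal ?_)
  have hm : √(m : ℝ) ≤ √((m + 1 : ℕ) : ℝ) := Real.sqrt_le_sqrt (by push_cast; linarith)
  have hb := B_nonneg (absMoment3 stdNormal)
  have hc := smoothingConst_nonneg
  generalize √((m + 1 : ℕ) : ℝ) = r at *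
  rw [← hs2]
  -- The unsmoothed first replacement is of the smaller order `r⁻³`; it is enlarged to `r⁻²` by `1 ≤
  -- r`.
  calc (1 / r) ^ 3 * (B (absMoment3 stdNormal) / 6 + 2 * smoothingConst * √(m : ℝ))
      ≤ (1 / r) ^ 3 * (B (absMoment3 stdNormal) / 6 * r + 2 * smoothingConst * r) := by
        gcongr
        exact le_mul_of_one_le_right (by positivity) hs1
    _ = _ := by field_simp

lemma epsilon_lt_top {n : ℕ} (hn : 1 ≤ n) : epsilon n < ∞ := by
  obtain ⟨b, -, hb⟩ := exists_epsilon_le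
  exact (hb n hn).trans_lt ENNReal.ofReal_lt_top

lemma zeta3_standardize_convPow_le {P : Measure ℝ} (hP : P ∈ P3) {n : ℕ} (hn : 1 ≤ n) :
    zeta3 (standardize (convPow P n)) stdNormal
      ≤ ENNReal.ofReal (B (rho P) / (6 * √(n : ℝ))) + epsilon n :=
  (zeta3_triangle _ (standardize (symBinomial n)) _).trans
    (add_le_add_left (zeta3_standardize_convPow_symBinomial_le hP hn) _)

lemma epsilon_le {P : Measure ℝ} (hP : P ∈ P3) {n : ℕ} (hn : 1 ≤ n) :
    epsilon n ≤ ENNReal.ofReal (B (rho P) / (6 * √(n : ℝ)))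
      + zeta3 (standardize (convPow P n)) stdNormal := by
  refine (zeta3_triangle _ (standardize (convPow P n)) _).trans (add_le_add_left ?_ _)
  rw [zeta3_comm]
  exact zeta3_standardize_convPow_symBinomial_le hP hn

lemma tendsto_zeta3_of_rho_tendsto_one {n : ℕ} (hn : 1 ≤ n) :
    Tendsto (fun P : Measure ℝ => zeta3 (standardize (convPow P n)) stdNormal)
      (comap rho (𝓝 1) ⊓ 𝓟 P3) (𝓝 (epsilon n)) := by
  have hB : Tendsto (fun P : Measure ℝ => ENNReal.ofReal (B (rho P) / (6 * √(n : ℝ))))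
      (comap rho (𝓝 1) ⊓ 𝓟 P3) (𝓝 0) := by
    have h1 : Tendsto rho (comap rho (𝓝 1) ⊓ 𝓟 P3) (𝓝 1) := tendsto_comap.mono_left inf_le_left
    have h2 : Tendsto (fun ρ => ENNReal.ofReal (B ρ / (6 * √(n : ℝ)))) (𝓝 1) (𝓝 0) := by
      have h3 := (ENNReal.continuous_ofReal.comp (continuous_B.div_const (6 * √(n : ℝ)))).tendsto 1
      simpa [B_one, Function.comp_def] using h3
    exact h2.comp h1
  have hmem : ∀ᶠ P in comap rho (𝓝 1) ⊓ 𝓟 P3, P ∈ P3 :=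
    mem_inf_of_right (mem_principal_self _)
  -- Subtraction in `ℝ≥0∞` is truncated, and its continuity here rests on finiteness of `epsilon n`.
  have hlow : Tendsto (fun P : Measure ℝ => epsilon n
      - ENNReal.ofReal (B (rho P) / (6 * √(n : ℝ)))) (comap rho (𝓝 1) ⊓ 𝓟 P3)
      (𝓝 (epsilon n)) := by
    simpa using ENNReal.Tendsto.sub (tendsto_const_nhds (x := epsilon n)) hB
      (Or.inl (epsilon_lt_top hn).ne)
  have hup : Tendsto (fun P : Measure ℝ => ENNReal.ofReal (B (rho P) / (6 * √(n : ℝ)))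
      + epsilon n) (comap rho (𝓝 1) ⊓ 𝓟 P3) (𝓝 (epsilon n)) := by
    simpa using hB.add (tendsto_const_nhds (x := epsilon n))
  refine tendsto_of_tendsto_of_tendsto_of_le_of_le' hlow hup ?_ ?_
  · filter_upwards [hmem] with P hP
    rw [tsub_le_iff_left]
    exact epsilon_le hP hn
  · filter_upwards [hmem] with P hP
    exact zeta3_standardize_convPow_le hP hn

/-! ### The cubic lower bound -/

lemma abs_sub_sin_le (y : ℝ) : |y - Real.sin y| ≤ 2 * |y| ^ 3 := by
  have h0 := abs_nonneg y
  rcases le_total |y| 1 with h | h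
  · have h1 := Real.sin_bound h
    have h2 : |y - Real.sin y| ≤ |y| ^ 3 / 6 + |y| ^ 5 / 100 := by
      have e : y - Real.sin y = y ^ 3 / 6 - (Real.sin y - (y - y ^ 3 / 6)) := by ring
      rw [e]
      refine (abs_sub _ _).trans (add_le_add (le_of_eq ?_) h1)
      rw [abs_div, abs_pow]; norm_num
    have h3 : |y| ^ 5 ≤ |y| ^ 3 := pow_le_pow_of_le_one h0 h (by norm_num)
    have : 0 ≤ |y| ^ 3 := by positivity
    linarith
  · have h1 : |y - Real.sin y| ≤ |y| + 1 := (abs_sub _ _).trans (by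
      gcongr; exact Real.abs_sin_le_one y)
    have : |y| ≤ |y| ^ 3 := by nlinarith [mul_nonneg h0 (sub_nonneg.2 h)]
    linarith

lemma tendsto_cube_mul_sub_sin (x : ℝ) :
    Tendsto (fun m : ℕ => ((m : ℝ) + 1) ^ 3 * (x / (m + 1) - Real.sin (x / (m + 1)))) atTop
      (𝓝 (x ^ 3 / 6)) := by
  have hlim : Tendsto (fun m : ℕ => |x| ^ 5 / 100 * (1 / ((m : ℝ) + 1) * (1 / ((m : ℝ) + 1)))) atTop
      (𝓝 0) := by
    have h := tendsto_one_div_add_atTop_nhds_zero_nat (𝕜 := ℝ)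
    have h2 := (h.mul h).const_mul (|x| ^ 5 / 100)
    rwa [mul_zero, mul_zero] at h2
  rw [tendsto_iff_norm_sub_tendsto_zero]
  refine squeeze_zero' (Eventually.of_forall fun _ => norm_nonneg _) ?_ hlim
  obtain ⟨N, hN⟩ := exists_nat_ge |x|
  filter_upwards [eventually_ge_atTop N] with m hm
  have hm' : |x| ≤ (m : ℝ) + 1 := hN.trans (by
    have : (N : ℝ) ≤ m := by exact_mod_cast hm
    linarith)
  have hp : 0 < (m : ℝ) + 1 := by positivity
  have h1 := Real.sin_bound (x := x / (m + 1)) (by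
    rw [abs_div, abs_of_pos hp, div_le_one hp]; exact hm')
  have e : ((m : ℝ) + 1) ^ 3 * (x / (m + 1) - Real.sin (x / (m + 1))) - x ^ 3 / 6
      = -(((m : ℝ) + 1) ^ 3 * (Real.sin (x / (m + 1)) - (x / (m + 1) - (x / (m + 1)) ^ 3 / 6))) := by
    field_simp; ring
  rw [e, norm_neg, norm_mul, Real.norm_of_nonneg (by positivity), Real.norm_eq_abs]
  refine (mul_le_mul_of_nonneg_left h1 (by positivity)).trans_eq ?_
  rw [abs_div, abs_of_pos hp]; field_simp

lemma tendsto_integral_cube_mul_sub_sin {μ : Measure ℝ}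
    (h : Integrable (fun x => |x| ^ 3) μ) :
    Tendsto (fun m : ℕ => ∫ x, ((m : ℝ) + 1) ^ 3 * (x / (m + 1) - Real.sin (x / (m + 1))) ∂μ) atTop
      (𝓝 (∫ x, cubic x ∂μ)) := by
  refine tendsto_integral_of_dominated_convergence (fun x => 2 * |x| ^ 3)
    (fun m => by fun_prop) (h.const_mul 2) (fun m => ae_of_all _ fun x => ?_)
    (ae_of_all _ tendsto_cube_mul_sub_sin)
  have hp : 0 < (m : ℝ) + 1 := by positivity
  rw [norm_mul, Real.norm_of_nonneg (by positivity), Real.norm_eq_abs]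
  refine (mul_le_mul_of_nonneg_left (abs_sub_sin_le _) (by positivity)).trans_eq ?_
  rw [abs_div, abs_of_pos hp]; field_simp

/-- Although `cubic` is unbounded, it is admissible for lower bounds of `zeta3` between centered
laws with finite third absolute moments. -/
lemma ofReal_abs_integral_cubic_sub_le_zeta3 {μ ν : Measure ℝ} [IsProbabilityMeasure μ]
    [IsProbabilityMeasure ν] (hμ : Integrable (fun x => |x| ^ 3) μ)
    (hν : Integrable (fun x => |x| ^ 3) ν) (hμ0 : ∫ x, x ∂μ = 0) (hν0 : ∫ x, x ∂ν = 0) :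
    ENNReal.ofReal |∫ x, cubic x ∂μ - ∫ x, cubic x ∂ν| ≤ zeta3 μ ν := by
  -- Centering lets the linear part of `M³ (x/M - sin (x/M))`, `M = m + 1`, integrate to zero. The
  -- bounded sine that remains lies in `F3b`, while the whole expression tends to `x³/6` under the
  -- dominating function `2|x|³`.
  have hlim := (ENNReal.continuous_ofReal.tendsto _).comp
    ((tendsto_integral_cube_mul_sub_sin hμ).sub (tendsto_integral_cube_mul_sub_sin hν)).abs
  refine le_of_tendsto hlim (Eventually.of_forall fun m => ?_)
  have hp : 0 < (m : ℝ) + 1 := by positivity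
  have hf := neg_cube_mul_sin_mem_F3b hp
  have key : ∀ κ : Measure ℝ, IsProbabilityMeasure κ → Integrable (fun x => |x| ^ 3) κ →
      ∫ x, x ∂κ = 0 → ∫ x, ((m : ℝ) + 1) ^ 3 * (x / (m + 1) - Real.sin (x / (m + 1))) ∂κ
        = ∫ x, -(((m : ℝ) + 1) ^ 3 * Real.sin (x / (m + 1))) ∂κ := fun κ _ hκ hκ0 => by
    have i1 : Integrable (fun x => ((m : ℝ) + 1) ^ 2 * x) κ :=
      (integrable_id_of_abs_cube hκ).const_mul _
    have e : ∀ x : ℝ, ((m : ℝ) + 1) ^ 3 * (x / (m + 1) - Real.sin (x / (m + 1)))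
        = ((m : ℝ) + 1) ^ 2 * x + -(((m : ℝ) + 1) ^ 3 * Real.sin (x / (m + 1))) := fun x => by
      field_simp; ring
    simp only [e]
    rw [integral_add i1 (F3b.integrable hf), integral_const_mul, hκ0]
    simp
  simp only [Function.comp_apply]
  rw [key μ inferInstance hμ hμ0, key ν inferInstance hν hν0]
  exact ofReal_le_zeta3 hf

lemma integrable_cubic {μ : Measure ℝ} (h : Integrable (fun x => |x| ^ 3) μ) :
    Integrable cubic μ :=
  (integrable_cube_of_abs_cube h).div_const 6

lemma integral_cubic_stdNormal : ∫ x, cubic x ∂stdNormal = 0 := by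
  have h := integral_stdNormal_comp_neg cubic (F3.continuous cubic_mem_F3).measurable
  have e : ∀ x, cubic (-x) = -cubic x := fun x => by rw [cubic, cubic]; ring
  simp only [e, integral_neg] at h
  linarith

lemma isStandard_convPow_map_div {μ : Measure ℝ} (h : IsStandard μ) {n : ℕ} (hn : 1 ≤ n) :
    IsStandard ((convPow μ n).map (fun x => x / √(n : ℝ))) := by
  have := h.prob
  have hs : 0 < √(n : ℝ) := Real.sqrt_pos.2 (by exact_mod_cast hn)
  have hs2 : √(n : ℝ) ^ 2 = n := Real.sq_sqrt (by positivity)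
  have hn0 : (n : ℝ) ≠ 0 := by positivity
  obtain ⟨i1, i2, i3, -⟩ := h.convPow_moments n
  refine ⟨Measure.isProbabilityMeasure_map (by fun_prop), ?_, ?_, ?_⟩
  · rw [integral_map (by fun_prop) (by fun_prop), integral_div, i2, zero_div]
  · rw [integral_map (by fun_prop) (by fun_prop)]
    simp only [div_pow]
    rw [integral_div, i3, hs2, div_self hn0]
  · rw [integrable_map_measure (by fun_prop) (by fun_prop)]
    refine (i1.div_const (√(n : ℝ) ^ 3)).congr (ae_of_all _ fun x => ?_)
    simp only [Function.comp_apply, abs_div, div_pow, abs_of_pos hs]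

lemma IsStandard.integral_cubic_convPow {μ : Measure ℝ} (h : IsStandard μ) {n : ℕ} (hn : 1 ≤ n) :
    √(n : ℝ) * ∫ x, cubic x ∂((convPow μ n).map (fun x => x / √(n : ℝ)))
      = (∫ x, x ^ 3 ∂μ) / 6 := by
  have hs : 0 < √(n : ℝ) := Real.sqrt_pos.2 (by exact_mod_cast hn)
  have hs2 : √(n : ℝ) ^ 2 = n := Real.sq_sqrt (by positivity)
  obtain ⟨-, -, -, i4⟩ := h.convPow_moments n
  rw [integral_map (by fun_prop) (F3.continuous cubic_mem_F3).aestronglyMeasurable]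
  simp only [cubic, div_pow]
  rw [integral_div, integral_div, i4]
  generalize √(n : ℝ) = r at *
  rw [← hs2]
  field_simp

/-! ### The extremal two-point laws -/

/-- Here `r = q - p`, so `1 - r² = 4pq` and `scale ρ = 1/√(pq)`. Thus `B ρ = (q - p)/√(pq)`, the
skewness of the Bernoulli law with parameter `p`. -/
lemma pRho_spec {ρ : ℝ} (hρ : 1 ≤ ρ) : ∃ r : ℝ, 0 ≤ r ∧ r < 1 ∧ pRho ρ = (1 - r) / 2 ∧
    1 - r ^ 2 = 4 / scale ρ ^ 2 ∧ scale ρ * r = B ρ := by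
  have hs := scale_pos ρ
  have h2 := two_le_scale hρ
  have hq : ρ / 2 * √(ρ ^ 2 + 8) - ρ ^ 2 / 2 - 1 = 1 - 4 / scale ρ ^ 2 := by
    have e1 : √(ρ ^ 2 + 8) = 2 * scale ρ - ρ := by rw [scale]; ring
    have h3 := scale_sq ρ
    have h4 : ρ = scale ρ - 2 / scale ρ := (scale_sub ρ).symm
    rw [e1]
    have e2 : ρ / 2 * (2 * scale ρ - ρ) - ρ ^ 2 / 2 - 1 = ρ * scale ρ - ρ ^ 2 - 1 := by ring
    rw [e2]
    generalize scale ρ = s at *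
    rw [h4]; field_simp; ring
  have hle : 4 / scale ρ ^ 2 ≤ 1 := by rw [div_le_one (by positivity)]; nlinarith
  have hpos : 0 < 4 / scale ρ ^ 2 := by positivity
  refine ⟨√(1 - 4 / scale ρ ^ 2), Real.sqrt_nonneg _, ?_, ?_, ?_, ?_⟩
  · rw [Real.sqrt_lt' one_pos]; linarith
  · rw [pRho, hq]; ring
  · rw [Real.sq_sqrt (by linarith)]; ring
  · rw [B_eq_sqrt_scale]
    conv_lhs => rw [← Real.sqrt_sq hs.le]
    rw [← Real.sqrt_mul (by positivity)]
    congr 1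
    rw [Real.sqrt_sq hs.le]; field_simp

lemma isStandard_PRho {ρ : ℝ} (hρ : 1 ≤ ρ) :
    IsStandard (PRho ρ) ∧ absMoment3 (PRho ρ) = ρ ∧ ∫ x, x ^ 3 ∂(PRho ρ) = B ρ := by
  obtain ⟨r, hr0, hr1, hp, hr2, hsr⟩ := pRho_spec hρ
  have hs := scale_pos ρ
  have hsub := scale_sub ρ
  set s := scale ρ
  have hq : 1 - pRho ρ = (1 + r) / 2 := by rw [hp]; ring
  have hrs : (1 - r ^ 2) * s ^ 2 = 4 := by rw [hr2]; field_simp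
  -- With `s = 1/√(pq)` the atoms are `-p s` and `q s`, so all moments become polynomials in `r` and
  -- `s`, reduced by `hrs`.
  have ha : √(pRho ρ / (1 - pRho ρ)) = (1 - r) / 2 * s := by
    rw [hq, hp, Real.sqrt_eq_iff_mul_self_eq (by
      apply div_nonneg <;> linarith) (by apply mul_nonneg <;> linarith)]
    rw [div_eq_iff (by linarith)]
    linear_combination -(1 - r) / 8 * hrs
  have hb : √((1 - pRho ρ) / pRho ρ) = (1 + r) / 2 * s := by
    rw [hq, hp, Real.sqrt_eq_iff_mul_self_eq (by
      apply div_nonneg <;> linarith) (by apply mul_nonneg <;> linarith)]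
    rw [div_eq_iff (by linarith)]
    linear_combination -(1 + r) / 8 * hrs
  have hint : ∀ f : ℝ → ℝ, ∫ x, f x ∂(PRho ρ)
      = (1 + r) / 2 * f (-((1 - r) / 2 * s)) + (1 - r) / 2 * f ((1 + r) / 2 * s) := fun f => by
    rw [PRho, integral_two_dirac (by simp) (by simp), ha, hb, hq, hp,
      ENNReal.toReal_ofReal (by linarith), ENNReal.toReal_ofReal (by linarith)]
  have hprob : IsProbabilityMeasure (PRho ρ) := ⟨by
    rw [PRho, hq, hp]
    simp only [Measure.coe_add, Measure.coe_smul, Pi.add_apply, Pi.smul_apply, measure_univ,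
      smul_eq_mul, mul_one]
    rw [← ENNReal.ofReal_add (by linarith) (by linarith)]
    rw [show (1 + r) / 2 + (1 - r) / 2 = 1 by ring, ENNReal.ofReal_one]⟩
  refine ⟨⟨hprob, ?_, ?_, integrable_two_dirac (by simp) (by simp) _ _ _⟩, ?_, ?_⟩
  · rw [hint]; ring
  · rw [hint]; linear_combination hrs / 4
  · rw [absMoment3, hint, abs_neg, abs_of_nonneg (by apply mul_nonneg <;> linarith),
      abs_of_nonneg (by apply mul_nonneg <;> linarith), ← hsub]
    have h2s : 2 / s = (1 - r ^ 2) * s / 2 := by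
      rw [div_eq_iff hs.ne']; linear_combination -hrs / 2
    rw [h2s]
    linear_combination (1 + r ^ 2) * s / 8 * hrs
  · rw [hint, ← hsr]
    linear_combination r * s / 4 * hrs

lemma sqrt_mul_abs_integral_cubic_PRho {ρ : ℝ} (hρ : 1 ≤ ρ) {k : ℕ} (hk : 1 ≤ k) :
    √(k : ℝ) * |(∫ x, cubic x ∂(standardize (convPow (PRho ρ) k))) - ∫ x, cubic x ∂stdNormal|
      = B ρ / 6 := by
  obtain ⟨h, -, h3⟩ := isStandard_PRho hρ
  rw [integral_cubic_stdNormal, sub_zero, h.standardize_convPow]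
  have e := h.integral_cubic_convPow hk
  rw [h3] at e
  rw [← abs_of_nonneg (Real.sqrt_nonneg (k : ℝ)), ← abs_mul, abs_of_nonneg (Real.sqrt_nonneg _), e,
    abs_of_nonneg (div_nonneg (B_nonneg ρ) (by norm_num))]

lemma tendsto_sqrt_mul_epsilon :
    Tendsto (fun n : ℕ => ENNReal.ofReal √(n : ℝ) * epsilon n) atTop (𝓝 0) := by
  obtain ⟨b, hb, hle⟩ := exists_epsilon_le
  have hlim : Tendsto (fun n : ℕ => ENNReal.ofReal (b / √(n : ℝ))) atTop (𝓝 0) := by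
    have h : Tendsto (fun n : ℕ => b / √(n : ℝ)) atTop (𝓝 0) :=
      tendsto_const_nhds.div_atTop (Real.tendsto_sqrt_atTop.comp tendsto_natCast_atTop_atTop)
    simpa [Function.comp_def] using (ENNReal.continuous_ofReal.tendsto 0).comp h
  refine tendsto_of_tendsto_of_tendsto_of_le_of_le' tendsto_const_nhds hlim
    (Eventually.of_forall fun _ => zero_le) ?_
  filter_upwards [eventually_ge_atTop 1] with n hn
  have hs : 0 < √(n : ℝ) := Real.sqrt_pos.2 (by exact_mod_cast hn)
  have hs2 : √(n : ℝ) ^ 2 = n := Real.sq_sqrt (by positivity)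
  refine (mul_le_mul_right (hle n hn) _).trans_eq ?_
  rw [← ENNReal.ofReal_mul hs.le]
  congr 1
  generalize √(n : ℝ) = r at *
  rw [← hs2]
  field_simp

/-- The cubic gives the lower bound `B ρ / 6` for every `n ≥ 1`. The upper bound exceeds it only by
`√n * epsilon n`, which tends to zero because `epsilon n` is of order `1/n`. -/
lemma tendsto_sqrt_mul_zeta3_PRho {ρ : ℝ} (hρ : 1 ≤ ρ) :
    Tendsto (fun n : ℕ => ENNReal.ofReal √(n : ℝ) *
        zeta3 (standardize (convPow (PRho ρ) n)) stdNormal)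
      atTop (𝓝 (ENNReal.ofReal (B ρ / 6))) := by
  obtain ⟨h, hm, -⟩ := isStandard_PRho hρ
  have hup : Tendsto (fun n : ℕ => ENNReal.ofReal (B ρ / 6)
      + ENNReal.ofReal √(n : ℝ) * epsilon n) atTop (𝓝 (ENNReal.ofReal (B ρ / 6))) := by
    simpa using (tendsto_const_nhds (x := ENNReal.ofReal (B ρ / 6))).add tendsto_sqrt_mul_epsilon
  refine tendsto_of_tendsto_of_tendsto_of_le_of_le' tendsto_const_nhds hup ?_ ?_
  · filter_upwards [eventually_ge_atTop 1] with n hn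
    have hst := isStandard_convPow_map_div h hn
    have := hst.prob
    rw [← sqrt_mul_abs_integral_cubic_PRho hρ hn, ENNReal.ofReal_mul (Real.sqrt_nonneg _),
      h.standardize_convPow]
    gcongr
    exact ofReal_abs_integral_cubic_sub_le_zeta3 hst.integrable_abs_cube
      isStandard_stdNormal.integrable_abs_cube hst.integral_id integral_id_stdNormal
  · filter_upwards [eventually_ge_atTop 1] with n hn
    have hs : 0 < √(n : ℝ) := Real.sqrt_pos.2 (by exact_mod_cast hn)
    refine (mul_le_mul_right (zeta3_standardize_convPow_le h.mem_P3 hn) _).trans_eq ?_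
    rw [mul_add, ← ENNReal.ofReal_mul hs.le, h.rho_eq, hm]
    congr 2
    field_simp

end BerryEsseenZeta

open BerryEsseenZeta
theorem theorem1p11 :
    -- the error bound, with finite remainder `ε_n`
    (∀ n : ℕ, 1 ≤ n → epsilon n < ∞) ∧
    (∀ P ∈ P3, ∀ n : ℕ, 1 ≤ n →
      zeta3 (standardize (convPow P n)) stdNormal ≤
        ENNReal.ofReal (BerryEsseenZeta.B (rho P) / (6 * √(n : ℝ))) + epsilon n) ∧
    -- optimality of the leading term for `n → ∞`
    cubic ∈ F3 ∧
    (∀ ρ : ℝ, 1 ≤ ρ →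
      PRho ρ ∈ P3 ∧ rho (PRho ρ) = ρ ∧
      Tendsto (fun n : ℕ => ENNReal.ofReal √(n : ℝ) *
          zeta3 (standardize (convPow (PRho ρ) n)) stdNormal)
        atTop (𝓝 (ENNReal.ofReal (BerryEsseenZeta.B ρ / 6))) ∧
      ∀ k : ℕ, 1 ≤ k →
        Integrable cubic (standardize (convPow (PRho ρ) k)) ∧
        Integrable cubic stdNormal ∧
        √(k : ℝ) * |(∫ x, cubic x ∂(standardize (convPow (PRho ρ) k))) -
            ∫ x, cubic x ∂stdNormal| = BerryEsseenZeta.B ρ / 6) ∧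
    -- asymptotic exactness for `ρ(P) → 1`, where `P` ranges over `𝓟₃`
    (∀ n : ℕ, 1 ≤ n →
      Tendsto (fun P : Measure ℝ => zeta3 (standardize (convPow P n)) stdNormal)
        (comap rho (𝓝 1) ⊓ 𝓟 P3) (𝓝 (epsilon n))) := by
  refine ⟨fun n hn => epsilon_lt_top hn, fun P hP n hn => zeta3_standardize_convPow_le hP hn,
    cubic_mem_F3, fun ρ hρ => ?_, fun n hn => tendsto_zeta3_of_rho_tendsto_one hn⟩
  obtain ⟨h, hm, -⟩ := isStandard_PRho hρ
  refine ⟨h.mem_P3, h.rho_eq.trans hm, tendsto_sqrt_mul_zeta3_PRho hρ, fun k hk =>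
    ⟨?_, integrable_cubic isStandard_stdNormal.integrable_abs_cube,
      sqrt_mul_abs_integral_cubic_PRho hρ hk⟩⟩
  rw [h.standardize_convPow]
  exact integrable_cubic (isStandard_convPow_map_div h hk).integrable_abs_cube
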